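/- All groups are finite. Let $G$ be a group, $p$ a prime, and let $\pi(X)$ denote the set of prime divisors of $|X|$; a positive integer is a $\pi(X)$-number if all its prime divisors belong to $\pi(X)$. A subgroup $I$ of $G$ satisfies the $\Pi$-property in $G$ if for every chief factor $L/K$ of $G$ the index $|G/K : N_{G/K}(IK/K\cap L/K)|$ is a $\pi(IK/K\cap L/K)$-number. A subgroup $H$ of $G$ is $\Pi$-supplemented in $G$ if there is a subgroup $T$ of $G$ with $G=HT$ and $H\cap T\le I\le H$ for some subgroup $I$ satisfying the $\Pi$-property in $G$. A supplement of $H$ in $G$ is a subgroup $T$ with $G=HT$. A group is $p$-supersoluble if each of its chief factors either has order prime to $p$ or has order $p$. A group is quaternion-free if none of its sections is isomorphic to the quaternion group of order $8$. Let $Z_{\mathcal U}(G)$ be the supersoluble hypercentre of $G$, that is, the product of all normal subgroups $N$ of $G$ such that for every chief factor $L/K$ of $G$ with $L\le N$ the semidirect product $(L/K)\rtimes(G/C_G(L/K))$ is supersoluble. **Theorem B.** Let $P$ be a normal $p$-subgroup of $G$. Suppose that $P$ has a subgroup $D$ with $1\le |D|<|P|$ such that every proper subgroup $H$ of $P$ with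 $|H|=p^n|D|$ ($n=0,1$) either is $\Pi$-supplemented in $G$ or has a $p$-supersoluble supplement in $G$. If $P$ is not quaternion-free and $|D|=1$, suppose further that every cyclic subgroup of $P$ of order $4$ either is $\Pi$-supplemented in $G$ or has a $2$-supersoluble supplement in $G$. Then $P\le Z_{\mathcal U}(G)$. -/

import Mathlib

namespace PiSupp

universe u

/-- For a normal subgroup `K` of `G`, the subgroup `HK/K` of `G/K`.
When `K ≤ L`, `factor K L` is the section `L/K`. -/
def factor {G : Type u} [Group G] (K L : Subgroup G) [K.Normal] : Subgroup (G ⧸ K) :=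
  L.map (QuotientGroup.mk' K)

instance factor_normal {G : Type u} [Group G] (K L : Subgroup G) [K.Normal] [hL : L.Normal] :
    (factor K L).Normal :=
  hL.map (QuotientGroup.mk' K) (QuotientGroup.mk'_surjective K)

/-- `L/K` is a chief factor of `G`: `K < L` are normal subgroups of `G` and no normal subgroup of
`G` lies strictly between them. -/
def IsChiefFactor {G : Type u} [Group G] (K L : Subgroup G) : Prop :=
  K.Normal ∧ L.Normal ∧ K < L ∧ ∀ M : Subgroup G, M.Normal → K ≤ M → M ≤ L → M = K ∨ M = L

/-- `m` is a `π(n)`-number: every prime divisor of `m` divides `n`. -/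
def IsPiNumberOf (m n : ℕ) : Prop :=
  ∀ q : ℕ, q.Prime → q ∣ m → q ∣ n

/-- `H` satisfies the `Π`-property in `G`: for every chief factor `L/K` of `G`, the index
`|G/K : N_{G/K}(HK/K ∩ L/K)|` is a `π(HK/K ∩ L/K)`-number. -/
def SatisfiesPiProperty {G : Type u} [Group G] (H : Subgroup G) : Prop :=
  ∀ (K L : Subgroup G) [K.Normal], IsChiefFactor K L →
    IsPiNumberOf (Subgroup.normalizer ((factor K H ⊓ factor K L : Subgroup (G ⧸ K)) : Set (G ⧸ K))).index
      (Nat.card (factor K H ⊓ factor K L : Subgroup (G ⧸ K)))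

/-- `T` is a supplement of `H` in `G`, that is, `G = HT`. -/
def IsSupplement {G : Type u} [Group G] (H T : Subgroup G) : Prop :=
  ∀ g : G, ∃ h ∈ H, ∃ t ∈ T, g = h * t

/-- `H` is `Π`-supplemented in `G`. -/
def IsPiSupplemented {G : Type u} [Group G] (H : Subgroup G) : Prop :=
  ∃ T : Subgroup G, IsSupplement H T ∧
    ∃ I : Subgroup G, H ⊓ T ≤ I ∧ I ≤ H ∧ SatisfiesPiProperty I

/-- `G` is `p`-supersoluble: every chief factor of `G` either has order prime to `p` or has
order `p`. -/
def IsPSupersoluble (p : ℕ) (G : Type u) [Group G] : Prop :=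
  ∀ (K L : Subgroup G) [K.Normal], IsChiefFactor K L →
    ¬ p ∣ Nat.card (factor K L) ∨ Nat.card (factor K L) = p

/-- `H` has a `p`-supersoluble supplement in `G`. -/
def HasPSupersolubleSupplement {G : Type u} [Group G] (p : ℕ) (H : Subgroup G) : Prop :=
  ∃ T : Subgroup G, IsSupplement H T ∧ IsPSupersoluble p T

/-- `G` is supersoluble: it has a finite series of normal subgroups of `G` from `1` to `G` with
cyclic factors. -/
def IsSupersoluble (G : Type u) [Group G] : Prop :=
  ∃ (n : ℕ) (N : ℕ → Subgroup G) (_ : ∀ i, (N i).Normal), N 0 = ⊥ ∧ N n = ⊤ ∧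
    ∀ i < n, N i ≤ N (i + 1) ∧ IsCyclic (factor (N i) (N (i + 1)))

/-- The conjugation action of `G` on `L/K`, for normal subgroups `K`, `L` of `G`. Its kernel is
`C_G(L/K)`. -/
def conjFactor {G : Type u} [Group G] (K L : Subgroup G) [K.Normal] [L.Normal] :
    G →* MulAut (factor K L) :=
  (MulAut.conjNormal (H := factor K L)).comp (QuotientGroup.mk' K)

/-- The semidirect product `(L/K) ⋊ (G/C_G(L/K))`. -/
abbrev FactorSemidirect {G : Type u} [Group G] (K L : Subgroup G) [K.Normal] [L.Normal] : Type u :=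
  factor K L ⋊[QuotientGroup.kerLift (conjFactor K L)] (G ⧸ (conjFactor K L).ker)

/-- For a class `F` of groups, the normal subgroup `N` is `F`-hypercentral in `G`: every chief
factor `L/K` of `G` below `N` is `F`-central, that is, `(L/K) ⋊ (G/C_G(L/K))` is in `F`. -/
def IsHypercentral (F : (X : Type u) → [Group X] → Prop) {G : Type u} [Group G]
    (N : Subgroup G) : Prop :=
  ∀ (K L : Subgroup G) [K.Normal] [L.Normal], IsChiefFactor K L → L ≤ N →
    F (FactorSemidirect K L)

/-- The `F`-hypercentre of `G`: the product of all `F`-hypercentral normal subgroups of `G`. -/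
def hypercentre (F : (X : Type u) → [Group X] → Prop) (G : Type u) [Group G] : Subgroup G :=
  sSup {N : Subgroup G | N.Normal ∧ IsHypercentral F N}

/-- The supersoluble hypercentre of `G`. -/
def supersolubleHypercentre (G : Type u) [Group G] : Subgroup G :=
  hypercentre (fun X _ => IsSupersoluble X) G

/-- `Q` is quaternion-free: no section `A/B` of `Q` is isomorphic to the quaternion group of
order 8. -/
def IsQuaternionFree (Q : Type u) [Group Q] : Prop :=
  ∀ (A : Subgroup Q) (B : Subgroup A) [B.Normal], IsEmpty (A ⧸ B ≃* QuaternionGroup 2)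

end PiSupp

/-! Let A be the set of elements of `residual p G` of prime power order for primes other than p;
`CentralMod p K L` says that A acts trivially on L/K. For a chief factor below a normal p-subgroup
this amounts to having order p. If the order is p, the automorphism group is abelian of exponent p -
1, so the whole residual acts trivially. Conversely, if A acts trivially, the residual induces a
p-group; its fixed points form a nontrivial invariant subgroup, so it acts trivially, and an abelian
group of exponent dividing p - 1 is diagonalisable over the field of p elements. Hence the goal
becomes `CentralMod p ⊥ P`. In this form the statement glues along normal series
(`CentralMod.trans`) and can be tested modulo the Frattini subgroup (`CentralMod.of_powComm`), both
by coprime action.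

Both supplement conditions enter through `HasGoodSupplement`. Let S be a Sylow p-subgroup. A
subgroup normalised by S whose normaliser has p-power index is normal. So if X has a good supplement
T containing a minimal normal subgroup N of G in P, and S normalises X ∩ N, then |N| = p or X ∩ N is
1 or N (`card_eq_or_inf_eq_bot_or_le`). The contradictions come from choosing X with X ∩ N an
S-invariant hyperplane of N.

If |D| = 1 (`centralMod_of_minimal_subgroups`), take a minimal normal subgroup P of G that is not
centralised by A. Then P = [P, A], so P centralises its proper normal subgroups and has exponent p,
or exponent dividing 4 when p = 2. Cyclic subgroups have no proper supplements, so the relevant ones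
have normalisers of p-power index and avoid every S-invariant maximal subgroup above R, where P/R is
chief. This forces |P/R| = p. In the quaternion-free case only involutions are available; one
outside R exists because otherwise a section is quaternion.

If |D| = p ^ a with a ≥ 1 (`centralMod_of_subgroups`), induct on a, the case a = 1 being the
previous one. A minimal normal N of order less than p ^ a may be factored out; it is then the only
minimal normal subgroup in P, and P is elementary abelian (`false_of_elementary`). Otherwise all
minimal normal subgroups in P have order p ^ a, and subgroups of both orders p ^ a and p ^ (a + 1)
are played against each other (`false_of_card_minimal_normal_eq`). -/

namespace PiSupp

universe u

/-! ### Coprime action of the residual on normal p-sections -/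

section Residual

variable {G : Type u} [Group G]

/-- The subgroup generated by all commutators and all `(p - 1)`-th powers: the smallest normal
subgroup with abelian quotient of exponent dividing `p - 1`. -/
def residual (p : ℕ) (G : Type u) [Group G] : Subgroup G :=
  Subgroup.closure ({x | ∃ g h : G, x = g * h * g⁻¹ * h⁻¹} ∪ {x | ∃ g : G, x = g ^ (p - 1)})

/-- `g` is an element of prime power order for a prime different from `p`. -/
def IsPrimaryCoprime (p : ℕ) (g : G) : Prop :=
  ∃ q : ℕ, q.Prime ∧ q ≠ p ∧ ∃ n : ℕ, g ^ q ^ n = 1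

/-- The elements of the residual of prime power order for a prime other than `p` centralise `L`
modulo `K`. -/
def CentralMod (p : ℕ) (K L : Subgroup G) : Prop :=
  ∀ g ∈ residual p G, IsPrimaryCoprime p g → ∀ x ∈ L, x⁻¹ * (g * x * g⁻¹) ∈ K

theorem residual_map_le {H : Type u} [Group H] (p : ℕ) (f : G →* H) :
    (residual p G).map f ≤ residual p H := by
  rw [residual, MonoidHom.map_closure, Subgroup.closure_le]
  rintro _ ⟨x, hx | hx, rfl⟩
  · obtain ⟨g, h, rfl⟩ := hx
    exact Subgroup.subset_closure (Or.inl ⟨f g, f h, by simp⟩)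
  · obtain ⟨g, rfl⟩ := hx
    exact Subgroup.subset_closure (Or.inr ⟨f g, by simp⟩)

instance residual_normal (p : ℕ) : (residual p G).Normal := by
  refine ⟨fun n hn g => ?_⟩
  have := residual_map_le p (MulAut.conj g).toMonoidHom (Subgroup.mem_map_of_mem _ hn)
  simpa using this

theorem residual_le_ker {H : Type*} [Group H] (p : ℕ) (f : G →* H)
    (hc : ∀ a b : G, f a * f b = f b * f a) (hp : ∀ a : G, f a ^ (p - 1) = 1) :
    residual p G ≤ f.ker := by
  rw [residual, Subgroup.closure_le]
  rintro x (⟨g, h, rfl⟩ | ⟨g, rfl⟩)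
  · simp [MonoidHom.mem_ker, hc g h]
  · simp [MonoidHom.mem_ker, hp g]

theorem IsPrimaryCoprime.map {H : Type*} [Group H] {p : ℕ} {g : G} (hg : IsPrimaryCoprime p g)
    (f : G →* H) : IsPrimaryCoprime p (f g) := by
  obtain ⟨q, hq, hqp, n, hn⟩ := hg
  exact ⟨q, hq, hqp, n, by rw [← map_pow, hn, map_one]⟩

theorem IsPrimaryCoprime.conj {p : ℕ} {g : G} (hg : IsPrimaryCoprime p g) (h : G) :
    IsPrimaryCoprime p (h * g * h⁻¹) := by
  simpa using hg.map (MulAut.conj h).toMonoidHom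

theorem CentralMod.mono_right {p : ℕ} {K L M : Subgroup G} (h : CentralMod p K L) (hM : M ≤ L) :
    CentralMod p K M :=
  fun g hg hg' x hx => h g hg hg' x (hM hx)

theorem CentralMod.mono_left {p : ℕ} {K L M : Subgroup G} (h : CentralMod p K L) (hM : K ≤ M) :
    CentralMod p M L :=
  fun g hg hg' x hx => hM (h g hg hg' x hx)

theorem centralMod_bot_iff {p : ℕ} {L : Subgroup G} :
    CentralMod p ⊥ L ↔ ∀ g ∈ residual p G, IsPrimaryCoprime p g → ∀ x ∈ L, g * x = x * g := by
  refine forall₂_congr fun g _ => forall_congr' fun _ => forall₂_congr fun x _ => ?_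
  rw [Subgroup.mem_bot, inv_mul_eq_one, eq_mul_inv_iff_mul_eq, eq_comm]

/-- An element whose order is both a power of `p` and a power of another prime is trivial. -/
theorem eq_one_of_pow_eq_one_of_ne {p q m k : ℕ} (hp : p.Prime) (hq : q.Prime) (hqp : q ≠ p)
    {c : G} (h1 : c ^ q ^ m = 1) (h2 : c ^ p ^ k = 1) : c = 1 := by
  have h : Nat.Coprime (q ^ m) (p ^ k) :=
    Nat.Coprime.pow _ _ ((Nat.coprime_primes hq hp).2 hqp)
  have := Nat.dvd_gcd (orderOf_dvd_of_pow_eq_one h1) (orderOf_dvd_of_pow_eq_one h2)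
  rw [h.gcd_eq_one, Nat.dvd_one, orderOf_eq_one_iff] at this
  exact this

theorem conj_pow_eq_mul_pow {g x c : G} (h1 : g * x * g⁻¹ = x * c) (h2 : g * c * g⁻¹ = c) (n : ℕ) :
    g ^ n * x * (g ^ n)⁻¹ = x * c ^ n := by
  induction n with
  | zero => simp
  | succ n ih =>
    have h3 : g * c ^ n * g⁻¹ = c ^ n := by rw [← conj_pow, h2]
    calc g ^ (n + 1) * x * (g ^ (n + 1))⁻¹ = g * (g ^ n * x * (g ^ n)⁻¹) * g⁻¹ := by
          rw [pow_succ']; group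
      _ = (g * x * g⁻¹) * (g * c ^ n * g⁻¹) := by rw [ih]; group
      _ = x * c ^ (n + 1) := by rw [h1, h3, mul_assoc, pow_succ']

/-- Iterating, `g ^ q ^ m = 1` sends x to `x * c ^ q ^ m`, so the order of c is a power of q as well
as of p. -/
theorem conj_eq_self_of_pow_eq_one {p q m k : ℕ} (hp : p.Prime) (hq : q.Prime) (hqp : q ≠ p)
    {g x c : G} (h1 : g * x * g⁻¹ = x * c) (h2 : g * c * g⁻¹ = c) (hg : g ^ q ^ m = 1)
    (hc : c ^ p ^ k = 1) : c = 1 := by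
  have := conj_pow_eq_mul_pow h1 h2 (q ^ m)
  rw [hg] at this
  exact eq_one_of_pow_eq_one_of_ne hp hq hqp (by simpa using this.symm) hc

/-- A p'-element acting trivially on both factors of a chain acts trivially on the whole. The
p-group hypothesis on M is what makes the displacement c a p-element. -/
theorem CentralMod.trans {p : ℕ} (hp : p.Prime) {K L M : Subgroup G} [hK : K.Normal]
    (hM : IsPGroup p M) (hL : L ≤ M) (h1 : CentralMod p K L) (h2 : CentralMod p L M) :
    CentralMod p K M := by
  intro g hg hg' x hx
  obtain ⟨q, hq, hqp, n, hn⟩ := id hg'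
  set c := x⁻¹ * (g * x * g⁻¹) with hc
  have hcL : c ∈ L := h2 g hg hg' x hx
  obtain ⟨k, hk⟩ := isPGroup_iff_pow_pow_eq_one.1 hM ⟨c, hL hcL⟩
  have hk' : c ^ p ^ k = 1 := by simpa [Subtype.ext_iff] using hk
  rw [← QuotientGroup.eq_one_iff]
  refine conj_eq_self_of_pow_eq_one (g := (g : G ⧸ K)) (x := (x : G ⧸ K)) (m := n) (k := k)
    hp hq hqp ?_ ?_ ?_ ?_
  · rw [hc]
    simp only [QuotientGroup.mk_mul, QuotientGroup.mk_inv]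
    group
  · have := h1 g hg hg' c hcL
    rw [← QuotientGroup.eq_one_iff] at this
    simp only [QuotientGroup.mk_mul, QuotientGroup.mk_inv] at this
    rw [inv_mul_eq_one] at this
    exact this.symm
  · rw [← QuotientGroup.mk_pow, hn, QuotientGroup.mk_one]
  · rw [← QuotientGroup.mk_pow, hk', QuotientGroup.mk_one]

theorem CentralMod.of_quotient {p : ℕ} {N P : Subgroup G} [N.Normal]
    (h : CentralMod p ⊥ (P.map (QuotientGroup.mk' N))) : CentralMod p N P := by
  intro g hg hg' x hx
  have := h (g : G ⧸ N) (residual_map_le p (QuotientGroup.mk' N) (Subgroup.mem_map_of_mem _ hg))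
    (hg'.map (QuotientGroup.mk' N)) x (Subgroup.mem_map_of_mem _ hx)
  rw [← QuotientGroup.eq_one_iff]
  simpa using this

end Residual

/-! ### Irreducible actions on p-groups -/

section Irreducible

/-- The endomorphism is a root of X ^ p - X, which splits over `ZMod p`; so its minimal polynomial
has a root there. -/
theorem exists_eigenvector_of_pow_eq_one {p : ℕ} [hp : Fact p.Prime] {M : Type*} [AddCommGroup M]
    [Module (ZMod p) M] [Finite M] [Nontrivial M] (f : Module.End (ZMod p) M)
    (hf : f ^ (p - 1) = 1) : ∃ (k : ℕ) (v : M), v ≠ 0 ∧ f v = k • v := by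
  have hf1 : f ^ p = f := by
    have h1 : f ^ (p - 1 + 1) = f := by rw [pow_succ, hf, one_mul]
    rwa [Nat.sub_add_cancel hp.out.one_le] at h1
  have hdvd : minpoly (ZMod p) f ∣ Polynomial.X ^ p - Polynomial.X :=
    minpoly.dvd _ _ (by simp [hf1])
  have hspl : (minpoly (ZMod p) f).Splits := by
    have h1 := FiniteField.splits_X_pow_card_sub_X (K := ZMod p) p
    have h2 := FiniteField.X_pow_card_sub_X_ne_zero (ZMod p) hp.out.one_lt
    simp at h1
    exact Polynomial.Splits.of_dvd h1 h2 hdvd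
  obtain ⟨μ, hμ⟩ := hspl.exists_eval_eq_zero
    (minpoly.degree_pos (Algebra.IsIntegral.isIntegral (R := ZMod p) f)).ne'
  obtain ⟨v, hv⟩ := (Module.End.hasEigenvalue_of_isRoot hμ).exists_hasEigenvector
  refine ⟨μ.val, v, hv.2, ?_⟩
  have h1 : f v = μ • v := hv.apply_eq_smul
  rw [h1, ← Nat.cast_smul_eq_nsmul (ZMod p), ZMod.natCast_zmod_val μ]

theorem exists_apply_eq_nsmul {p : ℕ} [hp : Fact p.Prime] {M : Type*} [AddCommGroup M]
    [Finite M] [Nontrivial M] (hexp : ∀ v : M, p • v = 0) (g : M →+ M)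
    (hg : ∀ v, g^[p - 1] v = v) : ∃ (k : ℕ) (v : M), v ≠ 0 ∧ g v = k • v := by
  let _ : Module (ZMod p) M := AddCommGroup.zmodModule hexp
  obtain ⟨k, v, hv, hk⟩ := exists_eigenvector_of_pow_eq_one
    (AddMonoidHom.toZModLinearMap p g : Module.End (ZMod p) M) (by
        refine LinearMap.ext fun v => ?_
        rw [Module.End.pow_apply]
        exact hg v)
  exact ⟨k, v, hv, hk⟩

/-- An automorphism of exponent dividing `p - 1` of a nontrivial elementary abelian `p`-group acts as
a power map on some nontrivial element. -/
theorem exists_apply_eq_pow {p : ℕ} [hp : Fact p.Prime] {V : Type*} [CommGroup V] [Finite V]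
    [Nontrivial V] (hexp : ∀ v : V, v ^ p = 1) (a : MulAut V) (ha : a ^ (p - 1) = 1) :
    ∃ (k : ℕ) (v : V), v ≠ 1 ∧ a v = v ^ k := by
  have hn : ∀ (n : ℕ) (v : V), (⇑a)^[n] v = (a ^ n) v := by
    intro n
    induction n with
    | zero => intro v; rfl
    | succ n ih => intro v; rw [Function.iterate_succ_apply, ih, pow_succ]; rfl
  obtain ⟨k, v, hv, hk⟩ := exists_apply_eq_nsmul (p := p) (M := Additive V)
    (fun v => congrArg Additive.ofMul (hexp v.toMul)) (MonoidHom.toAdditive a.toMonoidHom)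
    (fun v => by
      refine (hn (p - 1) v.toMul).trans ?_
      rw [ha]
      rfl)
  exact ⟨k, v.toMul, hv, hk⟩

/-- An abelian group of automorphisms of exponent dividing `p - 1` that acts irreducibly on a
`p`-group: the `p`-group has order `p`. -/
theorem card_eq_of_irreducible {p : ℕ} [hp : Fact p.Prime] {V : Type*} [Group V] [Finite V]
    [Nontrivial V] (hV : IsPGroup p V) (A : Subgroup (MulAut V))
    (hcomm : ∀ a ∈ A, ∀ b ∈ A, a * b = b * a) (hpow : ∀ a ∈ A, a ^ (p - 1) = 1)
    (hirr : ∀ W : Subgroup V, (∀ a ∈ A, ∀ w ∈ W, a w ∈ W) → W = ⊥ ∨ W = ⊤) :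
    Nat.card V = p := by
  have hcen : Subgroup.center V = ⊤ := by
    have := hV.bot_lt_center
    refine (hirr _ fun a _ w hw => ?_).resolve_left this.ne'
    rw [Subgroup.mem_center_iff] at hw ⊢
    intro g
    obtain ⟨g, rfl⟩ := a.surjective g
    rw [← map_mul, hw, map_mul]
  have hc : ∀ a b : V, a * b = b * a := fun a b =>
    Subgroup.mem_center_iff.1 (hcen ▸ Subgroup.mem_top b : b ∈ Subgroup.center V) a
  let _ : CommGroup V := { ‹Group V› with mul_comm := hc }
  obtain ⟨v₀, hv₀⟩ : ∃ v : V, orderOf v = p := by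
    obtain ⟨n, hn, hc⟩ := hV.nontrivial_iff_card.1 ‹_›
    exact exists_prime_orderOf_dvd_card' p (hc ▸ dvd_pow_self p hn.ne')
  have hv₀1 : v₀ ≠ 1 := by
    rintro rfl
    exact hp.out.one_lt.ne (by simpa using hv₀)
  have hexp : ∀ v : V, v ^ p = 1 := by
    have : (powMonoidHom p : V →* V).ker = ⊤ := by
      refine (hirr _ fun a _ w hw => ?_).resolve_left fun h => hv₀1 ?_
      · rw [MonoidHom.mem_ker, powMonoidHom_apply] at hw ⊢
        rw [← map_pow, hw, map_one]
      · rw [← Subgroup.mem_bot, ← h, MonoidHom.mem_ker, powMonoidHom_apply, ← hv₀,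
          pow_orderOf_eq_one]
    intro v
    have hv : v ∈ (powMonoidHom p : V →* V).ker := this ▸ Subgroup.mem_top v
    simpa using hv
  have hpw : ∀ a ∈ A, ∃ k : ℕ, ∀ v : V, a v = v ^ k := by
    intro a ha
    obtain ⟨k, v₁, hv₁, hk⟩ := exists_apply_eq_pow hexp a (hpow a ha)
    refine ⟨k, ?_⟩
    -- The eigenspace of `a` for k. It is invariant under A because A is abelian, and nontrivial,
    -- hence everything; so every subgroup of V is invariant.
    let W : Subgroup V := ((a : MulAut V).toMonoidHom).eqLocus (powMonoidHom k)
    have hmem : ∀ v, v ∈ W ↔ a v = v ^ k := fun v => Iff.rfl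
    have hW : W = ⊤ := by
      refine (hirr W fun b hb w hw => ?_).resolve_left fun h => hv₁ ?_
      · rw [hmem] at hw ⊢
        rw [← map_pow, ← hw, ← MulAut.mul_apply, ← MulAut.mul_apply, hcomm a ha b hb]
      · rw [← Subgroup.mem_bot, ← h]
        exact (hmem _).2 hk
    intro v
    exact (hmem v).1 (hW ▸ Subgroup.mem_top v)
  have htop : Subgroup.zpowers v₀ = ⊤ := by
    refine (hirr _ fun a ha w hw => ?_).resolve_left fun h => hv₀1 (Subgroup.zpowers_eq_bot.1 h)
    obtain ⟨k, hk⟩ := hpw a ha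
    rw [hk]
    exact Subgroup.pow_mem _ hw k
  rw [← hv₀, ← Nat.card_zpowers, htop, Subgroup.card_top]

/-- The residual induces a p-group on V, which has nontrivial fixed points. These form an invariant
subgroup since the residual is normal, so the residual acts trivially and `card_eq_of_irreducible`
applies to the image of G. -/
theorem card_eq_of_irreducible_of_residual {p : ℕ} [hp : Fact p.Prime] {G : Type u} [Group G]
    [Finite G] {V : Type*} [Group V] [Finite V] [Nontrivial V] (hV : IsPGroup p V)
    (φ : G →* MulAut V) (hφ : ∀ g ∈ residual p G, IsPrimaryCoprime p g → φ g = 1)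
    (hirr : ∀ W : Subgroup V, (∀ g, ∀ w ∈ W, φ g w ∈ W) → W = ⊥ ∨ W = ⊤) :
    Nat.card V = p := by
  have hI : IsPGroup p ((residual p G).map φ) := by
    rw [isPGroup_iff_primeFactors_card_subset hp.out.ne_zero]
    intro q hq
    have hqp := Nat.prime_of_mem_primeFactors hq
    have : Fact q.Prime := ⟨hqp⟩
    obtain ⟨⟨x, hx⟩, hxq⟩ := exists_prime_orderOf_dvd_card' q (Nat.dvd_of_mem_primeFactors hq)
    rw [Subgroup.orderOf_mk] at hxq
    by_contra hne
    have hne : q ≠ p := fun h => hne (by simp [h, hp.out])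
    obtain ⟨b, hb, rfl⟩ := hx
    -- Here `b ^ m` is a q-element of the residual, so it acts trivially; but the image of b has
    -- order q, which does not divide m.
    obtain ⟨m, hm⟩ : ∃ m, ¬ q ∣ m ∧ ∃ n, orderOf b = q ^ n * m := by
      obtain ⟨n, m, h1, h2⟩ := Nat.exists_eq_pow_mul_and_not_dvd (orderOf_pos b).ne' q hqp.ne_one
      exact ⟨m, h1, n, h2⟩
    obtain ⟨hm, n, hn⟩ := hm
    have h1 : φ (b ^ m) = 1 := by
      refine hφ _ (Subgroup.pow_mem _ hb m) ⟨q, hqp, hne, n, ?_⟩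
      rw [← pow_mul, mul_comm, ← hn, pow_orderOf_eq_one]
    rw [map_pow] at h1
    exact hm (hxq ▸ orderOf_dvd_of_pow_eq_one h1)
  have hker : residual p G ≤ φ.ker := by
    let A := (residual p G).map φ
    let F : Subgroup V :=
      { carrier := {v | ∀ a ∈ A, a v = v}
        mul_mem' := fun {x y} hx hy a ha => by rw [map_mul, hx a ha, hy a ha]
        one_mem' := fun a _ => map_one a
        inv_mem' := fun {x} hx a ha => by rw [map_inv, hx a ha] }
    have hF : F = ⊤ := by
      refine (hirr F fun g w hw a ha => ?_).resolve_left fun h => ?_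
      · obtain ⟨b, hb, rfl⟩ := ha
        have h1 : φ (g⁻¹ * b * g) ∈ A := by
          refine Subgroup.mem_map_of_mem _ ?_
          simpa using (residual_normal (G := G) p).conj_mem b hb g⁻¹
        have h2 := hw _ h1
        rw [map_mul, map_mul, map_inv, MulAut.mul_apply, MulAut.mul_apply] at h2
        have h3 := congrArg (φ g) h2
        rwa [MulAut.apply_inv_self] at h3
      · obtain ⟨n, hn, hc⟩ := hV.nontrivial_iff_card.1 ‹_›
        obtain ⟨v, hv, hv1⟩ := hI.exists_fixed_point_of_prime_dvd_card_of_fixed_point V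
          (hc ▸ dvd_pow_self p hn.ne') (a := 1) (fun a => smul_one a)
        apply hv1
        symm
        rw [← Subgroup.mem_bot, ← h]
        exact fun a ha => hv ⟨a, ha⟩
    intro b hb
    rw [MonoidHom.mem_ker]
    ext v
    exact (hF ▸ Subgroup.mem_top v : v ∈ F) _ (Subgroup.mem_map_of_mem _ hb)
  refine card_eq_of_irreducible hV φ.range ?_ ?_ ?_
  · rintro _ ⟨g, rfl⟩ _ ⟨h, rfl⟩
    have : φ (g * h * g⁻¹ * h⁻¹) = 1 := hker (Subgroup.subset_closure (Or.inl ⟨g, h, rfl⟩))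
    simp only [map_mul, map_inv] at this
    rw [mul_inv_eq_one, mul_inv_eq_iff_eq_mul] at this
    exact this
  · rintro _ ⟨g, rfl⟩
    rw [← map_pow]
    exact hker (Subgroup.subset_closure (Or.inr ⟨g, rfl⟩))
  · intro W hW
    exact hirr W fun g w hw => hW _ ⟨g, rfl⟩ w hw

end Irreducible

/-! ### Chief factors of order p and centrality -/

section Factor

variable {G : Type u} [Group G]

theorem card_factor (K L : Subgroup G) [K.Normal] : Nat.card (factor K L) = K.relIndex L := by
  have := Subgroup.relIndex_ker (K := L) (QuotientGroup.mk' K)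
  rw [QuotientGroup.ker_mk'] at this
  exact this.symm

theorem conjFactor_apply_mk (K L : Subgroup G) [K.Normal] [L.Normal] (g x : G)
    (hx : (x : G ⧸ K) ∈ factor K L) :
    ((conjFactor K L g ⟨x, hx⟩ : factor K L) : G ⧸ K) = ((g * x * g⁻¹ : G) : G ⧸ K) := rfl

theorem mk_mem_factor {K L : Subgroup G} [K.Normal] {x : G} (hx : x ∈ L) :
    (x : G ⧸ K) ∈ factor K L := Subgroup.mem_map_of_mem (QuotientGroup.mk' K) hx

theorem IsChiefFactor.relIndex_eq [Finite G] {p : ℕ} (hp : p.Prime) {K L : Subgroup G}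
    (h : IsChiefFactor K L) (hL : IsPGroup p L) (hc : CentralMod p K L) : K.relIndex L = p := by
  have : Fact p.Prime := ⟨hp⟩
  have hK := h.1
  have hLn := h.2.1
  rw [← card_factor]
  have hnt : Nontrivial (factor K L) := by
    rw [← Finite.one_lt_card_iff_nontrivial, card_factor]
    have h1 : K.relIndex L ≠ 1 := fun h1 => not_le_of_gt h.2.2.1 (Subgroup.relIndex_eq_one.1 h1)
    have h2 : K.relIndex L ≠ 0 := Subgroup.index_ne_zero_of_finite
    omega
  have hV : IsPGroup p (factor K L) := hL.map _
  refine card_eq_of_irreducible_of_residual hV (conjFactor K L) ?_ ?_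
  · intro g hg hg'
    ext ⟨_, x, hx, rfl⟩
    have h1 := hc g hg hg' x hx
    exact (QuotientGroup.eq.2 h1).symm
  · intro W hW
    -- Invariant subgroups of L/K correspond to normal subgroups of G between K and L, of which a
    -- chief factor has only two.
    set M : Subgroup G := (W.map (factor K L).subtype).comap (QuotientGroup.mk' K) with hM
    have hmem : ∀ x : G, x ∈ M ↔ ∃ hx : (x : G ⧸ K) ∈ factor K L, ⟨x, hx⟩ ∈ W := by
      intro x
      rw [hM, Subgroup.mem_comap, Subgroup.mem_map]
      constructor
      · rintro ⟨⟨w, hw⟩, hwW, rfl⟩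
        exact ⟨hw, hwW⟩
      · rintro ⟨hx, hxW⟩
        exact ⟨_, hxW, rfl⟩
    have hMn : M.Normal := by
      refine ⟨fun x hx g => ?_⟩
      obtain ⟨hx, hxW⟩ := (hmem x).1 hx
      exact (hmem _).2 ⟨(conjFactor K L g ⟨x, hx⟩).2, hW g _ hxW⟩
    have hKM : K ≤ M := fun x hx => by
      have : (x : G ⧸ K) = 1 := (QuotientGroup.eq_one_iff x).2 hx
      rw [hmem]
      simp only [this]
      exact ⟨one_mem _, one_mem W⟩
    have hML : M ≤ L := fun x hx => by
      obtain ⟨⟨y, hy, hyx⟩, -⟩ := (hmem x).1 hx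
      have := h.2.2.1.le (QuotientGroup.eq.1 hyx)
      simpa using L.mul_mem hy this
    rcases h.2.2.2 M hMn hKM hML with h1 | h1
    · left
      rw [eq_bot_iff]
      rintro ⟨_, x, hx, rfl⟩ hw
      have : x ∈ K := h1 ▸ (hmem x).2 ⟨_, hw⟩
      rw [Subgroup.mem_bot, Subtype.ext_iff]
      exact (QuotientGroup.eq_one_iff x).2 this
    · right
      rw [eq_top_iff]
      rintro ⟨_, x, hx, rfl⟩ -
      have : x ∈ M := h1 ▸ hx
      exact ((hmem x).1 this).2

theorem conjFactor_comm_pow {p : ℕ} (hp : p.Prime) {K L : Subgroup G} [K.Normal] [L.Normal]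
    (h : K.relIndex L = p) :
    (∀ a b : G, conjFactor K L a * conjFactor K L b = conjFactor K L b * conjFactor K L a) ∧
      ∀ a : G, conjFactor K L a ^ (p - 1) = 1 := by
  have : Fact p.Prime := ⟨hp⟩
  have hcard : Nat.card (factor K L) = p := (card_factor K L).trans h
  have hcyc : IsCyclic (factor K L) := isCyclic_of_prime_card hcard
  let e := IsCyclic.mulAutMulEquiv (factor K L)
  refine ⟨fun a b => e.injective ?_, fun a => e.injective ?_⟩
  · rw [map_mul, map_mul, mul_comm]
  · rw [map_pow, map_one]
    have h1 : ∀ (n : ℕ), n = p → ∀ u : (ZMod n)ˣ, u ^ (p - 1) = 1 := by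
      rintro n rfl u
      exact ZMod.units_pow_card_sub_one_eq_one n u
    exact h1 _ hcard _

theorem centralMod_of_relIndex_eq {p : ℕ} (hp : p.Prime) {K L : Subgroup G} [K.Normal] [L.Normal]
    (h : K.relIndex L = p) : CentralMod p K L := by
  obtain ⟨h1, h2⟩ := conjFactor_comm_pow hp h
  intro g hg _ x hx
  have h3 : conjFactor K L g = 1 := residual_le_ker p _ h1 h2 hg
  have h4 := conjFactor_apply_mk K L g x (mk_mem_factor hx)
  rw [h3] at h4
  exact QuotientGroup.eq.1 h4

/-- Peel off a top chief factor, central because it has order p, and glue it to the smaller normal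
subgroup below by `CentralMod.trans`. -/
theorem centralMod_of_chief [Finite G] {p : ℕ} (hp : p.Prime) {P : Subgroup G} (hPn : P.Normal)
    (hP : IsPGroup p P)
    (h : ∀ K L : Subgroup G, IsChiefFactor K L → L ≤ P → K.relIndex L = p) : CentralMod p ⊥ P := by
  induction hn : Nat.card P using Nat.strong_induction_on generalizing P with
  | _ n ih =>
    by_cases hb : P = ⊥
    · subst hb
      rw [centralMod_bot_iff]
      intro g _ _ x hx
      rw [Subgroup.mem_bot.1 hx]; simp
    · obtain ⟨K, ⟨hK1, hK2⟩, hK3⟩ : ∃ K, Maximal (fun K : Subgroup G => K.Normal ∧ K < P) K :=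
        Set.Finite.exists_maximal (Set.toFinite {K : Subgroup G | K.Normal ∧ K < P})
          ⟨⊥, inferInstance, bot_lt_iff_ne_bot.2 hb⟩
      have hch : IsChiefFactor K P := by
        refine ⟨hK1, hPn, hK2, fun M hM h1 h2 => ?_⟩
        by_cases hMP : M = P
        · exact Or.inr hMP
        · exact Or.inl (le_antisymm (hK3 ⟨hM, lt_of_le_of_ne h2 hMP⟩ h1) h1)
      have h1 := ih (Nat.card K) (hn ▸ Set.ncard_lt_ncard hK2 (Set.toFinite _)) hK1 (hP.to_le hK2.le)
        (fun A B hAB hB => h A B hAB (hB.trans hK2.le)) rfl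
      exact h1.trans hp hP hK2.le (centralMod_of_relIndex_eq hp (h K P hch le_rfl))

end Factor

end PiSupp

namespace PiSupp

universe u

/-! ### Invariant subgroups of p-groups and Sylow subgroups -/

section PGroups

variable {G : Type u} [Group G]

/-- `S` normalises `X`. -/
def Normalizes (S X : Subgroup G) : Prop :=
  ∀ s ∈ S, ∀ x ∈ X, s * x * s⁻¹ ∈ X

theorem normalizes_iff {S X : Subgroup G} :
    Normalizes S X ↔ S ≤ Subgroup.normalizer (X : Set G) :=
  Subgroup.le_normalizer_iff.symm

theorem normalizes_of_normal (S : Subgroup G) {X : Subgroup G} (h : X.Normal) : Normalizes S X :=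
  fun s _ x hx => h.conj_mem x hx s

theorem Normalizes.inf {S X Y : Subgroup G} (hX : Normalizes S X) (hY : Normalizes S Y) :
    Normalizes S (X ⊓ Y) :=
  fun s hs x hx => ⟨hX s hs x hx.1, hY s hs x hx.2⟩

theorem normalizes_iff_map_le {S X : Subgroup G} :
    Normalizes S X ↔ ∀ s ∈ S, X.map (MulAut.conj s).toMonoidHom ≤ X := by
  refine forall₂_congr fun s _ => ?_
  rw [Subgroup.map_le_iff_le_comap]
  rfl

theorem Normalizes.sup {S X Y : Subgroup G} (hX : Normalizes S X) (hY : Normalizes S Y) :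
    Normalizes S (X ⊔ Y) := by
  rw [normalizes_iff_map_le] at *
  intro s hs
  rw [Subgroup.map_sup]
  exact sup_le_sup (hX s hs) (hY s hs)

theorem Normalizes.self (X : Subgroup G) : Normalizes X X :=
  fun _ hs _ hx => X.mul_mem (X.mul_mem hs hx) (X.inv_mem hs)

theorem normalizes_closure {S : Subgroup G} {E : Set G}
    (h : ∀ s ∈ S, ∀ x ∈ E, s * x * s⁻¹ ∈ Subgroup.closure E) :
    Normalizes S (Subgroup.closure E) := by
  rw [normalizes_iff_map_le]
  intro s hs
  rw [MonoidHom.map_closure, Subgroup.closure_le]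
  rintro _ ⟨x, hx, rfl⟩
  exact h s hs x hx

theorem normal_of_normalizes_top {X : Subgroup G} (h : Normalizes ⊤ X) : X.Normal :=
  ⟨fun x hx s => h s trivial x hx⟩

theorem Normalizes.of_commute {S X : Subgroup G} (h : ∀ s ∈ S, ∀ x ∈ X, s * x = x * s) :
    Normalizes S X :=
  fun s hs x hx => by rwa [h s hs x hx, mul_inv_cancel_right]

theorem mem_sup_iff_of_normalizes {X Y : Subgroup G} (h : Normalizes Y X) {z : G} :
    z ∈ X ⊔ Y ↔ ∃ x ∈ X, ∃ y ∈ Y, x * y = z := by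
  rw [← SetLike.mem_coe, Subgroup.coe_mul_of_right_le_normalizer_left X Y (normalizes_iff.1 h),
    Set.mem_mul]
  rfl

theorem relIndex_sup_of_normalizes {X Y : Subgroup G} (h : Normalizes Y X) :
    X.relIndex (Y ⊔ X) = X.relIndex Y := by
  have h1 := Subgroup.normal_subgroupOf_of_le_normalizer (normalizes_iff.1 h)
  have h2 := Subgroup.normal_subgroupOf_sup_of_le_normalizer (normalizes_iff.1 h)
  exact Nat.card_congr
    (QuotientGroup.quotientInfEquivProdNormalizerQuotient Y X (normalizes_iff.1 h)).toEquiv.symm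

theorem card_mul_relIndex {X Y : Subgroup G} (h : X ≤ Y) :
    Nat.card X * X.relIndex Y = Nat.card Y := by
  have := Subgroup.relIndex_mul_relIndex ⊥ X Y bot_le h
  rwa [Subgroup.relIndex_bot_left, Subgroup.relIndex_bot_left] at this

theorem card_sup_of_disjoint {X Y : Subgroup G} (h : Normalizes Y X) (hd : X ⊓ Y = ⊥) :
    Nat.card (X ⊔ Y : Subgroup G) = Nat.card X * Nat.card Y := by
  rw [← card_mul_relIndex (le_sup_left : X ≤ X ⊔ Y), sup_comm X Y, relIndex_sup_of_normalizes h,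
    ← Subgroup.inf_relIndex_right, hd, Subgroup.relIndex_bot_left]

theorem card_lt_card_of_lt [Finite G] {X Y : Subgroup G} (h : X < Y) : Nat.card X < Nat.card Y :=
  Set.ncard_lt_ncard h (Set.toFinite _)

theorem eq_of_le_of_card_eq [Finite G] {X Y : Subgroup G} (h : X ≤ Y)
    (hc : Nat.card X = Nat.card Y) : X = Y := by
  by_contra hne
  exact (card_lt_card_of_lt (lt_of_le_of_ne h hne)).ne hc

theorem eq_or_eq_of_relIndex_prime [Finite G] {p : ℕ} (hp : p.Prime) {C M P : Subgroup G}
    (h : C.relIndex P = p) (hCM : C ≤ M) (hMP : M ≤ P) : M = C ∨ M = P := by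
  have h1 := Subgroup.relIndex_mul_relIndex C M P hCM hMP
  rw [h] at h1
  rcases (Nat.dvd_prime hp).1 (Dvd.intro _ h1) with h2 | h2
  · exact Or.inl (le_antisymm (Subgroup.relIndex_eq_one.1 h2) hCM)
  · right
    rw [h2] at h1
    have h3 : M.relIndex P = 1 := Nat.eq_of_mul_eq_mul_left hp.pos (by rw [h1, mul_one])
    exact le_antisymm hMP (Subgroup.relIndex_eq_one.1 h3)

theorem relIndex_zpowers_of_pow_mem {p : ℕ} (hp : p.Prime) {X : Subgroup G} {x : G} (hx : x ∉ X)
    (hxp : x ^ p ∈ X) (hn : Normalizes (Subgroup.zpowers x) X) :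
    X.relIndex (Subgroup.zpowers x ⊔ X) = p := by
  rw [relIndex_sup_of_normalizes hn]
  have hN : (X.subgroupOf (Subgroup.zpowers x)).Normal :=
    Subgroup.normal_subgroupOf_of_le_normalizer (normalizes_iff.1 hn)
  let Q := Subgroup.zpowers x ⧸ X.subgroupOf (Subgroup.zpowers x)
  let g : Q := ((⟨x, Subgroup.mem_zpowers x⟩ : Subgroup.zpowers x) : Q)
  have hg : ∀ y : Q, y ∈ Subgroup.zpowers g := by
    intro y
    obtain ⟨⟨y, hy⟩, rfl⟩ := QuotientGroup.mk_surjective y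
    obtain ⟨k, rfl⟩ := Subgroup.mem_zpowers_iff.1 hy
    exact ⟨k, rfl⟩
  have ho : orderOf g = p := by
    refine orderOf_eq_prime (hp := ⟨hp⟩) ?_ ?_
    · exact (QuotientGroup.eq_one_iff (N := X.subgroupOf (Subgroup.zpowers x))
        (⟨x, Subgroup.mem_zpowers x⟩ ^ p : Subgroup.zpowers x)).2 hxp
    · exact fun h => hx ((QuotientGroup.eq_one_iff (N := X.subgroupOf (Subgroup.zpowers x))
        (⟨x, Subgroup.mem_zpowers x⟩ : Subgroup.zpowers x)).1 h)
  change Nat.card Q = p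
  rw [← ho, ← Nat.card_zpowers, (Subgroup.eq_top_iff' _).2 hg, Subgroup.card_top]

theorem pow_mem_of_relIndex_prime {p : ℕ} (hp : p.Prime) {C P : Subgroup G}
    (h : C.relIndex P = p) (hn : Normalizes P C) :
    (∀ x ∈ P, x ^ p ∈ C) ∧ ∀ x ∈ P, ∀ y ∈ P, x * y * x⁻¹ * y⁻¹ ∈ C := by
  have : Fact p.Prime := ⟨hp⟩
  have hN : (C.subgroupOf P).Normal :=
    Subgroup.normal_subgroupOf_of_le_normalizer (normalizes_iff.1 hn)
  have hc : Nat.card (P ⧸ C.subgroupOf P) = p := h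
  have hcyc : IsCyclic (P ⧸ C.subgroupOf P) := isCyclic_of_prime_card hc
  let _ := hcyc.commGroup
  constructor
  · intro x hx
    have h1 : ((⟨x, hx⟩ : P) : P ⧸ C.subgroupOf P) ^ p = 1 := by rw [← hc, pow_card_eq_one']
    rw [← QuotientGroup.mk_pow, QuotientGroup.eq_one_iff] at h1
    exact h1
  · intro x hx y hy
    have h1 : ((⟨x, hx⟩ * ⟨y, hy⟩ * ⟨x, hx⟩⁻¹ * ⟨y, hy⟩⁻¹ : P) : P ⧸ C.subgroupOf P) = 1 := by
      simp only [QuotientGroup.mk_mul, QuotientGroup.mk_inv]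
      rw [mul_inv_eq_one, mul_inv_eq_iff_eq_mul]
      exact mul_comm _ _
    rw [QuotientGroup.eq_one_iff] at h1
    exact h1

variable [Finite G]

/-- By Sylow's theorem M lies in a subgroup of order |P|/p, which is normal since its index is the
smallest prime divisor of |P|. -/
theorem exists_relIndex_prime {p : ℕ} (hp : p.Prime) {M P : Subgroup G} (hP : IsPGroup p P)
    (h : M < P) : ∃ C : Subgroup G, M ≤ C ∧ C ≤ P ∧ C.relIndex P = p ∧ Normalizes P C := by
  have : Fact p.Prime := ⟨hp⟩
  obtain ⟨n, hn⟩ := IsPGroup.iff_card.1 hP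
  obtain ⟨m, hm⟩ := IsPGroup.iff_card.1 (hP.to_le h.le)
  have hlt := card_lt_card_of_lt h
  rw [hn, hm, Nat.pow_lt_pow_iff_right hp.one_lt] at hlt
  have hm' : Nat.card (M.subgroupOf P) = p ^ m := by
    rw [← hm]
    exact Nat.card_congr (Subgroup.subgroupOfEquivOfLe h.le).toEquiv
  obtain ⟨K, hK, hMK⟩ := Sylow.exists_subgroup_card_pow_prime_le p (n := m) (m := n - 1)
    (hn ▸ pow_dvd_pow p (Nat.sub_le _ _)) (M.subgroupOf P) hm' (by omega)
  have hidx : K.index = p := by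
    have h1 := K.card_mul_index
    have h2 : p ^ n = p ^ (n - 1) * p := by rw [← pow_succ]; congr 1; omega
    rw [hK, hn, h2] at h1
    exact Nat.eq_of_mul_eq_mul_left (pow_pos hp.pos _) h1
  have hKn : K.Normal := by
    refine Subgroup.normal_of_index_eq_minFac_card ?_
    rw [hidx, hn, Nat.Prime.pow_minFac hp (by omega)]
  refine ⟨K.map P.subtype, ?_, Subgroup.map_subtype_le K, ?_, ?_⟩
  · intro x hx
    exact ⟨⟨x, h.le hx⟩, hMK hx, rfl⟩
  · rw [Subgroup.relIndex, Subgroup.subgroupOf,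
      Subgroup.comap_map_eq_self_of_injective P.subtype_injective, hidx]
  · rintro s hs _ ⟨x, hx, rfl⟩
    exact ⟨⟨s, hs⟩ * x * ⟨s, hs⟩⁻¹, hKn.conj_mem x hx _, rfl⟩

/-- A nontrivial normal subgroup of a finite `p`-group contains a central element of order `p`. -/
theorem exists_central_orderOf_eq {p : ℕ} (hp : p.Prime) (hG : IsPGroup p G) {N : Subgroup G}
    [N.Normal] (hN : N ≠ ⊥) : ∃ z ∈ N, orderOf z = p ∧ ∀ g : G, g * z = z * g := by
  have : Fact p.Prime := ⟨hp⟩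
  have hc : p ∣ Nat.card N := by
    refine ((hG.to_subgroup N).card_eq_or_dvd).resolve_left fun h => hN ?_
    exact Subgroup.card_eq_one.1 h
  obtain ⟨z, hz, hz1⟩ := (hG.of_equiv ConjAct.toConjAct
    ).exists_fixed_point_of_prime_dvd_card_of_fixed_point N hc (a := 1) (fun a => smul_one a)
  have hI : N ⊓ Subgroup.center G ≠ ⊥ := by
    intro h
    apply hz1
    symm
    rw [Subtype.ext_iff]
    refine Subgroup.mem_bot.1 (h ▸ ⟨z.2, Subgroup.mem_center_iff.2 fun g => ?_⟩)
    have h1 := congrArg Subtype.val (hz (ConjAct.toConjAct g))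
    change g * z * g⁻¹ = z at h1
    rwa [mul_inv_eq_iff_eq_mul] at h1
  have hd : p ∣ Nat.card (N ⊓ Subgroup.center G : Subgroup G) :=
    ((hG.to_subgroup _).card_eq_or_dvd).resolve_left fun h => hI (Subgroup.card_eq_one.1 h)
  obtain ⟨⟨y, hy⟩, hyp⟩ := exists_prime_orderOf_dvd_card' p hd
  rw [Subgroup.orderOf_mk] at hyp
  exact ⟨y, hy.1, hyp, Subgroup.mem_center_iff.1 hy.2⟩

/-- Take the preimage of a subgroup of order p of Q/R that is central in S/R. Repeating this gives
S-invariant subgroups of every intermediate order. -/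
theorem exists_normalizes_card_mul {p : ℕ} (hp : p.Prime) {S R Q : Subgroup G}
    (hS : IsPGroup p S) (hQS : Q ≤ S) (hRQ : R < Q) (hR : Normalizes S R) (hQ : Normalizes S Q) :
    ∃ U : Subgroup G, R ≤ U ∧ U ≤ Q ∧ Normalizes S U ∧ Nat.card U = p * Nat.card R := by
  have hRS := hRQ.le.trans hQS
  have hRn : (R.subgroupOf S).Normal :=
    Subgroup.normal_subgroupOf_of_le_normalizer (normalizes_iff.1 hR)
  have hQn : (Q.subgroupOf S).Normal :=
    Subgroup.normal_subgroupOf_of_le_normalizer (normalizes_iff.1 hQ)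
  let π := QuotientGroup.mk' (R.subgroupOf S)
  have hπ : Function.Surjective π := QuotientGroup.mk'_surjective _
  have hNn : ((Q.subgroupOf S).map π).Normal := hQn.map π hπ
  have hN : (Q.subgroupOf S).map π ≠ ⊥ := by
    intro h
    rw [Subgroup.map_eq_bot_iff, QuotientGroup.ker_mk'] at h
    exact not_le_of_gt hRQ fun x hx => h (show (⟨x, hQS hx⟩ : S) ∈ Q.subgroupOf S from hx)
  obtain ⟨_, ⟨z, hz, rfl⟩, hzp, hzc⟩ :=
    exists_central_orderOf_eq hp (hS.to_quotient (R.subgroupOf S)) hN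
  let W := (Subgroup.zpowers (π z)).comap π
  have hWR : R.subgroupOf S ≤ W := by
    intro x hx
    have : π x = 1 := (QuotientGroup.eq_one_iff x).2 hx
    rw [Subgroup.mem_comap, this]
    exact one_mem _
  have hWQ : W ≤ Q.subgroupOf S := by
    intro x hx
    obtain ⟨k, hk⟩ := Subgroup.mem_zpowers_iff.1 (Subgroup.mem_comap.1 hx)
    rw [← map_zpow] at hk
    have h1 : (z ^ k)⁻¹ * x ∈ R.subgroupOf S := QuotientGroup.eq.1 hk
    have h2 : (z ^ k)⁻¹ * x ∈ Q.subgroupOf S := hRQ.le h1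
    have h3 := (Q.subgroupOf S).mul_mem ((Q.subgroupOf S).zpow_mem hz k) h2
    rwa [mul_inv_cancel_left] at h3
  have hWn : W.Normal := by
    refine ⟨fun x hx g => ?_⟩
    obtain ⟨k, hk⟩ := Subgroup.mem_zpowers_iff.1 (Subgroup.mem_comap.1 hx)
    rw [Subgroup.mem_comap, map_mul, map_mul, map_inv, ← hk]
    have : Commute (π g) (π z ^ k) := Commute.zpow_right (hzc (π g)) k
    rw [this.eq, mul_inv_cancel_right]
    exact Subgroup.zpow_mem _ (Subgroup.mem_zpowers _) k
  have hcard : Nat.card W = p * Nat.card (R.subgroupOf S) := by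
    have h1 : (R.subgroupOf S).relIndex W = p := by
      have h2 := Subgroup.relIndex_ker (K := W) π
      rw [QuotientGroup.ker_mk', Subgroup.map_comap_eq_self_of_surjective hπ, Nat.card_zpowers,
        hzp] at h2
      exact h2
    rw [← card_mul_relIndex hWR, h1, mul_comm]
  refine ⟨W.map S.subtype, ?_, ?_, ?_, ?_⟩
  · intro x hx
    exact ⟨⟨x, hRS hx⟩, hWR hx, rfl⟩
  · rintro _ ⟨x, hx, rfl⟩
    exact hWQ hx
  · rintro s hs _ ⟨x, hx, rfl⟩
    exact ⟨⟨s, hs⟩ * x * ⟨s, hs⟩⁻¹, hWn.conj_mem x hx _, rfl⟩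
  · rw [Subgroup.card_subtype, hcard]
    congr 1
    exact Nat.card_congr (Subgroup.subgroupOfEquivOfLe hRS).toEquiv

theorem exists_normalizes_card_eq {p : ℕ} (hp : p.Prime) {S R Q : Subgroup G}
    (hS : IsPGroup p S) (hQS : Q ≤ S) (hRQ : R ≤ Q) (hR : Normalizes S R) (hQ : Normalizes S Q)
    {k : ℕ} (h1 : Nat.card R ≤ p ^ k) (h2 : p ^ k ≤ Nat.card Q) :
    ∃ U : Subgroup G, R ≤ U ∧ U ≤ Q ∧ Normalizes S U ∧ Nat.card U = p ^ k := by
  have : Fact p.Prime := ⟨hp⟩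
  obtain ⟨j, hj⟩ := IsPGroup.iff_card.1 (hS.to_le (hRQ.trans hQS))
  rw [hj, Nat.pow_le_pow_iff_right hp.one_lt] at h1
  obtain ⟨i, rfl⟩ := Nat.exists_eq_add_of_le h1
  induction i generalizing j R with
  | zero => exact ⟨R, le_rfl, hRQ, hR, hj⟩
  | succ i ih =>
    have hlt : R < Q := by
      refine lt_of_le_of_ne hRQ ?_
      rintro rfl
      rw [hj, Nat.pow_le_pow_iff_right hp.one_lt] at h2
      omega
    obtain ⟨U, hU1, hU2, hU3, hU4⟩ := exists_normalizes_card_mul hp hS hQS hlt hR hQ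
    rw [hj, ← pow_succ'] at hU4
    have h3 : j + (i + 1) = j + 1 + i := by omega
    rw [h3] at h2 ⊢
    obtain ⟨W, hW1, hW2⟩ := ih hU2 hU3 (j + 1) hU4 h2 (by omega)
    exact ⟨W, hU1.trans hW1, hW2⟩

theorem exists_normalizes_relIndex {p : ℕ} (hp : p.Prime) {S R Q : Subgroup G}
    (hS : IsPGroup p S) (hQS : Q ≤ S) (hRQ : R < Q) (hR : Normalizes S R) (hQ : Normalizes S Q) :
    ∃ U : Subgroup G, R ≤ U ∧ U ≤ Q ∧ Normalizes S U ∧ U.relIndex Q = p := by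
  have : Fact p.Prime := ⟨hp⟩
  obtain ⟨n, hn⟩ := IsPGroup.iff_card.1 (hS.to_le hQS)
  obtain ⟨m, hm⟩ := IsPGroup.iff_card.1 (hS.to_le (hRQ.le.trans hQS))
  have hlt := card_lt_card_of_lt hRQ
  rw [hn, hm, Nat.pow_lt_pow_iff_right hp.one_lt] at hlt
  obtain ⟨k, rfl⟩ := Nat.exists_eq_add_of_lt hlt
  obtain ⟨U, hU1, hU2, hU3, hU4⟩ := exists_normalizes_card_eq hp hS hQS hRQ.le hR hQ (k := m + k)
    (hm ▸ Nat.pow_le_pow_right hp.pos (by omega)) (hn ▸ Nat.pow_le_pow_right hp.pos (by omega))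
  refine ⟨U, hU1, hU2, hU3, ?_⟩
  have h1 := card_mul_relIndex hU2
  rw [hU4, hn, pow_succ] at h1
  exact Nat.eq_of_mul_eq_mul_left (pow_pos hp.pos _) h1

theorem exists_minimal_normal {Q : Subgroup G} (hQ : Q.Normal) (hb : Q ≠ ⊥) :
    ∃ N : Subgroup G, N ≤ Q ∧ IsChiefFactor ⊥ N := by
  obtain ⟨N, hNQ, ⟨hN1, hN2⟩, hN3⟩ :=
    (Set.toFinite {K : Subgroup G | K.Normal ∧ K ≠ ⊥}).exists_le_minimal (a := Q) ⟨hQ, hb⟩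
  refine ⟨N, hNQ, inferInstance, hN1, bot_lt_iff_ne_bot.2 hN2, fun M hM _ hMN => ?_⟩
  by_cases h : M = ⊥
  · exact Or.inl h
  · exact Or.inr (le_antisymm hMN (hN3 ⟨hM, h⟩ hMN))

theorem exists_maximal_normal {P : Subgroup G} (hP : P.Normal) (hb : P ≠ ⊥) :
    ∃ R : Subgroup G, IsChiefFactor R P := by
  obtain ⟨K, ⟨hK1, hK2⟩, hK3⟩ := Set.Finite.exists_maximal
    (Set.toFinite {K : Subgroup G | K.Normal ∧ K < P}) ⟨⊥, inferInstance, bot_lt_iff_ne_bot.2 hb⟩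
  refine ⟨K, hK1, hP, hK2, fun M hM h1 h2 => ?_⟩
  by_cases hMP : M = P
  · exact Or.inr hMP
  · exact Or.inl (le_antisymm (hK3 ⟨hM, lt_of_le_of_ne h2 hMP⟩ h1) h1)

/-- A minimal normal subgroup inside a normal `p`-subgroup `P` is centralised by `P`. -/
theorem commute_of_minimal_normal {p : ℕ} (hp : p.Prime) {N P : Subgroup G} (hPn : P.Normal)
    (hP : IsPGroup p P) (hN : IsChiefFactor ⊥ N) (hNP : N ≤ P) :
    ∀ x ∈ P, ∀ n ∈ N, x * n = n * x := by
  have hNn := hN.2.1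
  have h1 : N.subgroupOf P ≠ ⊥ := by
    intro h
    rw [Subgroup.subgroupOf_eq_bot, disjoint_iff, inf_eq_left.2 hNP] at h
    exact hN.2.2.1.ne' h
  obtain ⟨⟨z, hzP⟩, hzN, hzp, hzc⟩ := exists_central_orderOf_eq hp hP h1
  rw [Subgroup.orderOf_mk] at hzp
  have h2 : N ⊓ Subgroup.centralizer (P : Set G) = N := by
    refine (hN.2.2.2 _ inferInstance bot_le inf_le_left).resolve_left fun h => ?_
    have : z ∈ N ⊓ Subgroup.centralizer (P : Set G) := by
      refine ⟨hzN, Subgroup.mem_centralizer_iff.2 fun x hx => ?_⟩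
      exact congrArg Subtype.val (hzc ⟨x, hx⟩)
    rw [h, Subgroup.mem_bot] at this
    rw [this, orderOf_one] at hzp
    exact hp.one_lt.ne hzp
  intro x hx n hn
  rw [← h2] at hn
  exact Subgroup.mem_centralizer_iff.1 hn.2 x hx

/-- As |G : S| is prime to p, the index p ^ k of N divides |S : S ∩ N|; so the cosets of N met by S
are all of them. -/
theorem mem_mul_sylow {p : ℕ} (hp : p.Prime) (S : Sylow p G) {N : Subgroup G} {k : ℕ}
    (hN : N.index = p ^ k) (g : G) : ∃ s ∈ S, ∃ n ∈ N, g = s * n := by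
  have : Fact p.Prime := ⟨hp⟩
  have h1 : p ^ k ∣ N.relIndex (S : Subgroup G) := by
    have h2 : p ^ k ∣ N.relIndex (S : Subgroup G) * (S : Subgroup G).index := by
      rw [← Subgroup.inf_relIndex_right, Subgroup.relIndex_mul_index inf_le_right, ← hN]
      exact Subgroup.index_dvd_of_le inf_le_left
    refine Nat.Coprime.dvd_of_dvd_mul_right ?_ h2
    exact Nat.Coprime.pow_left k ((Nat.Prime.coprime_iff_not_dvd hp).2 S.not_dvd_index)
  let f : (S : Subgroup G) ⧸ N.subgroupOf (S : Subgroup G) → G ⧸ N :=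
    Quotient.map' (fun s => (s : G)) (by
      intro a b h
      rw [QuotientGroup.leftRel_apply] at h ⊢
      exact h)
  have hf : Function.Injective f := by
    intro a b hab
    obtain ⟨a, rfl⟩ := QuotientGroup.mk_surjective a
    obtain ⟨b, rfl⟩ := QuotientGroup.mk_surjective b
    have h3 : ((a : G) : G ⧸ N) = ((b : G) : G ⧸ N) := hab
    rw [QuotientGroup.eq] at h3 ⊢
    exact h3
  have hb : Function.Bijective f := by
    rw [Nat.bijective_iff_injective_and_card]
    refine ⟨hf, le_antisymm (Nat.card_le_card_of_injective f hf) ?_⟩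
    change N.index ≤ N.relIndex (S : Subgroup G)
    rw [hN]
    exact Nat.le_of_dvd (Nat.pos_of_ne_zero Subgroup.index_ne_zero_of_finite) h1
  obtain ⟨a, ha⟩ := hb.2 (g : G ⧸ N)
  obtain ⟨a, rfl⟩ := QuotientGroup.mk_surjective a
  have h3 : ((a : G) : G ⧸ N) = (g : G ⧸ N) := ha
  rw [QuotientGroup.eq] at h3
  exact ⟨a, a.2, _, h3, by group⟩

/-- The group is the product of S and the normaliser of X, and both normalise X. This turns the
Π-property into normality. -/
theorem normal_of_normalizes_sylow {p : ℕ} (hp : p.Prime) (S : Sylow p G) {X : Subgroup G} {k : ℕ}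
    (hX : (Subgroup.normalizer (X : Set G)).index = p ^ k) (hS : Normalizes (S : Subgroup G) X) :
    X.Normal := by
  refine ⟨fun x hx g => ?_⟩
  obtain ⟨s, hs, n, hn, rfl⟩ := mem_mul_sylow hp S hX g
  have h1 := (Subgroup.mem_normalizer_iff.1 hn x).1 hx
  have h2 := hS s hs _ h1
  simpa [mul_assoc] using h2

end PGroups

/-! ### The Frattini subgroup of a normal p-subgroup -/

section Frattini

variable {G : Type u} [Group G]

/-- The subgroup generated by the `p`-th powers and the commutators of elements of `P`. -/
def powComm (p : ℕ) (P : Subgroup G) : Subgroup G :=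
  Subgroup.closure ({z | ∃ x ∈ P, z = x ^ p} ∪ {z | ∃ x ∈ P, ∃ y ∈ P, z = x * y * x⁻¹ * y⁻¹})

theorem pow_mem_powComm {p : ℕ} {P : Subgroup G} {x : G} (hx : x ∈ P) : x ^ p ∈ powComm p P :=
  Subgroup.subset_closure (Or.inl ⟨x, hx, rfl⟩)

theorem comm_mem_powComm {p : ℕ} {P : Subgroup G} {x y : G} (hx : x ∈ P) (hy : y ∈ P) :
    x * y * x⁻¹ * y⁻¹ ∈ powComm p P :=
  Subgroup.subset_closure (Or.inr ⟨x, hx, y, hy, rfl⟩)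

theorem powComm_le (p : ℕ) (P : Subgroup G) : powComm p P ≤ P := by
  rw [powComm, Subgroup.closure_le]
  rintro _ (⟨x, hx, rfl⟩ | ⟨x, hx, y, hy, rfl⟩)
  · exact P.pow_mem hx p
  · exact P.mul_mem (P.mul_mem (P.mul_mem hx hy) (P.inv_mem hx)) (P.inv_mem hy)

theorem powComm_normal (p : ℕ) {P : Subgroup G} (hP : P.Normal) : (powComm p P).Normal := by
  refine normal_of_normalizes_top (normalizes_closure ?_)
  rintro s - _ (⟨x, hx, rfl⟩ | ⟨x, hx, y, hy, rfl⟩)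
  · rw [← conj_pow]
    exact pow_mem_powComm (hP.conj_mem x hx s)
  · have := comm_mem_powComm (p := p) (hP.conj_mem x hx s) (hP.conj_mem y hy s)
    have h1 : s * (x * y * x⁻¹ * y⁻¹) * s⁻¹ =
        s * x * s⁻¹ * (s * y * s⁻¹) * (s * x * s⁻¹)⁻¹ * (s * y * s⁻¹)⁻¹ := by group
    rw [h1]
    exact this

theorem powComm_le_of_relIndex_prime {p : ℕ} (hp : p.Prime) {C P : Subgroup G}
    (h : C.relIndex P = p) (hn : Normalizes P C) : powComm p P ≤ C := by
  obtain ⟨h1, h2⟩ := pow_mem_of_relIndex_prime hp h hn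
  rw [powComm, Subgroup.closure_le]
  rintro _ (⟨x, hx, rfl⟩ | ⟨x, hx, y, hy, rfl⟩)
  · exact h1 x hx
  · exact h2 x hx y hy

variable [Finite G]

/-- The subgroup generated by `p`-th powers and commutators consists of non-generators. -/
theorem sup_powComm_lt {p : ℕ} (hp : p.Prime) {M P : Subgroup G} (hP : IsPGroup p P) (h : M < P) :
    M ⊔ powComm p P < P := by
  obtain ⟨C, h1, h2, h3, h4⟩ := exists_relIndex_prime hp hP h
  refine lt_of_le_of_lt (sup_le h1 (powComm_le_of_relIndex_prime hp h3 h4))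
    (lt_of_le_of_ne h2 ?_)
  rintro rfl
  rw [Subgroup.relIndex_self] at h3
  exact hp.one_lt.ne h3

/-- An element of the residual acting trivially modulo the Frattini subgroup acts trivially. -/
theorem CentralMod.of_powComm {p : ℕ} (hp : p.Prime) {P : Subgroup G} (hPn : P.Normal)
    (hP : IsPGroup p P) (h : CentralMod p (powComm p P) P) : CentralMod p ⊥ P := by
  rw [centralMod_bot_iff]
  intro g hg hg'
  obtain ⟨q, hq, hqp, n, hn⟩ := id hg'
  have : Fact q.Prime := ⟨hq⟩
  have : Fact p.Prime := ⟨hp⟩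
  have hΦ := powComm_normal p hPn
  set C := P ⊓ Subgroup.centralizer {g} with hC
  have hCP : C = P := by
    by_contra hne
    have hlt := sup_powComm_lt hp hP (lt_of_le_of_ne (inf_le_left : C ≤ P) hne)
    apply hlt.not_ge
    intro x hx
    have hqg : IsPGroup q (Subgroup.zpowers g) := by
      refine IsPGroup.of_card_dvd_pow (n := n) ?_
      rw [Nat.card_zpowers]
      exact orderOf_dvd_of_pow_eq_one hn
    -- The q-group generated by g acts by conjugation on this coset of the Frattini subgroup, whose
    -- size is a power of p. A fixed point puts x into the product of C and the Frattini subgroup,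
    -- which is proper if C is.
    let Y : Set G := {y | x⁻¹ * y ∈ powComm p P}
    have hinv : ∀ (t : Subgroup.zpowers g) (y : G), y ∈ Y → (t : G) * y * (t : G)⁻¹ ∈ Y := by
      have key : ∀ k ∈ Subgroup.zpowers g, x⁻¹ * (k * x * k⁻¹) ∈ powComm p P := by
        intro k hk
        have hk1 : k ∈ residual p G :=
          (Subgroup.zpowers_le (H := residual p G)).2 hg hk
        obtain ⟨j, hj⟩ := isPGroup_iff_pow_pow_eq_one.1 hqg ⟨k, hk⟩
        exact h k hk1 ⟨q, hq, hqp, j, by simpa [Subtype.ext_iff] using hj⟩ x hx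
      intro t y hy
      have h1 := hΦ.conj_mem _ hy (t : G)
      have h2 := (powComm p P).mul_mem (key t t.2) h1
      change x⁻¹ * (t * y * (t : G)⁻¹) ∈ powComm p P
      convert h2 using 1
      group
    let act : MulAction (Subgroup.zpowers g) Y :=
      { smul := fun t y => ⟨(t : G) * y * (t : G)⁻¹, hinv t y y.2⟩
        one_smul := fun y => Subtype.ext (by change (1 : G) * y * (1 : G)⁻¹ = y; simp)
        mul_smul := fun s t y => Subtype.ext (by
          change ((s * t : G)) * y * (s * t : G)⁻¹ = s * (t * y * (t : G)⁻¹) * (s : G)⁻¹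
          group) }
    have hcY : ¬ q ∣ Nat.card Y := by
      have e : Y ≃ powComm p P :=
        { toFun := fun y => ⟨x⁻¹ * y, y.2⟩
          invFun := fun z => ⟨x * z, by
            change x⁻¹ * (x * z) ∈ powComm p P
            simp⟩
          left_inv := fun y => by simp
          right_inv := fun y => by simp }
      rw [Nat.card_congr e]
      obtain ⟨j, hj⟩ := IsPGroup.iff_card.1 (hP.to_le (powComm_le p P))
      rw [hj]
      intro hd
      exact hqp ((Nat.prime_dvd_prime_iff_eq hq hp).1 (hq.dvd_of_dvd_pow hd))
    obtain ⟨⟨y, hy⟩, hfix⟩ := hqg.nonempty_fixed_point_of_prime_not_dvd_card Y hcY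
    have hgy : g * y * g⁻¹ = y :=
      congrArg Subtype.val (hfix ⟨g, Subgroup.mem_zpowers g⟩)
    have hyP : y ∈ P := by
      have h1 := P.mul_mem hx (powComm_le p P hy)
      rwa [mul_inv_cancel_left] at h1
    have hyC : y ∈ C := by
      refine ⟨hyP, Subgroup.mem_centralizer_singleton_iff.2 ?_⟩
      exact (mul_inv_eq_iff_eq_mul.1 hgy).symm
    have h1 := (C ⊔ powComm p P).mul_mem (Subgroup.mem_sup_left hyC)
      (Subgroup.mem_sup_right ((powComm p P).inv_mem hy))
    rwa [mul_inv_rev, inv_inv, mul_inv_cancel_left] at h1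
  intro x hx
  rw [← hCP] at hx
  exact (Subgroup.mem_centralizer_singleton_iff.1 hx.2).symm

end Frattini

end PiSupp

namespace PiSupp

universe u

/-! ### The supplement conditions and their passage to quotients -/

section Transfer

variable {G H : Type u} [Group G] [Group H]

/-- For every chief factor `L/K`, the normaliser of `IK ∩ L` has `p`-power index. -/
def PPowerNormalizers (p : ℕ) (I : Subgroup G) : Prop :=
  ∀ K L : Subgroup G, IsChiefFactor K L →
    ∃ k : ℕ, (Subgroup.normalizer (((I ⊔ K) ⊓ L : Subgroup G) : Set G)).index = p ^ k

/-- The common form of the two supplement conditions for a `p`-subgroup. -/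
def HasGoodSupplement (p : ℕ) (X : Subgroup G) : Prop :=
  ∃ T : Subgroup G, IsSupplement X T ∧
    (IsPSupersoluble p T ∨ ∃ I : Subgroup G, X ⊓ T ≤ I ∧ I ≤ X ∧ PPowerNormalizers p I)

/-- For a p-subgroup I the intersection IK/K ∩ L/K is a p-group, so the only prime its index
condition allows is p. -/
theorem SatisfiesPiProperty.pPowerNormalizers [Finite G] {p : ℕ} (hp : p.Prime) {I : Subgroup G}
    (hI : IsPGroup p I) (h : SatisfiesPiProperty I) : PPowerNormalizers p I := by
  intro K L hKL
  have : Fact p.Prime := ⟨hp⟩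
  have hK := hKL.1
  have h1 := h K L hKL
  have hsurj := QuotientGroup.mk'_surjective K
  have h2 : (factor K I ⊓ factor K L).comap (QuotientGroup.mk' K) = (I ⊔ K) ⊓ L := by
    rw [Subgroup.comap_inf, factor, factor, Subgroup.comap_map_eq, Subgroup.comap_map_eq,
      QuotientGroup.ker_mk', sup_eq_left.2 hKL.2.2.1.le]
  rw [← Subgroup.index_comap_of_surjective _ hsurj,
    Subgroup.comap_normalizer_eq_of_surjective _ hsurj, h2] at h1
  obtain ⟨j, hj⟩ : ∃ j, Nat.card (factor K I ⊓ factor K L : Subgroup (G ⧸ K)) = p ^ j :=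
    IsPGroup.iff_card.1 ((hI.map (QuotientGroup.mk' K)).to_le inf_le_left)
  rw [hj] at h1
  refine ⟨_, Nat.eq_prime_pow_of_unique_prime_dvd Subgroup.index_ne_zero_of_finite
    fun {q} hq hqd => ?_⟩
  exact (Nat.prime_dvd_prime_iff_eq hq hp).1 (hq.dvd_of_dvd_pow (h1 q hq hqd))

theorem hasGoodSupplement_of [Finite G] {p : ℕ} (hp : p.Prime) {X : Subgroup G}
    (hX : IsPGroup p X) (h : IsPiSupplemented X ∨ HasPSupersolubleSupplement p X) :
    HasGoodSupplement p X := by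
  rcases h with ⟨T, hT, I, h1, h2, h3⟩ | ⟨T, hT, h1⟩
  · exact ⟨T, hT, Or.inr ⟨I, h1, h2, h3.pPowerNormalizers hp (hX.to_le h2)⟩⟩
  · exact ⟨T, hT, Or.inl h1⟩

theorem IsChiefFactor.comap {f : G →* H} (hf : Function.Surjective f) {K L : Subgroup H}
    (h : IsChiefFactor K L) : IsChiefFactor (K.comap f) (L.comap f) := by
  obtain ⟨hK, hL, hlt, hM⟩ := h
  refine ⟨hK.comap f, hL.comap f, (Subgroup.comap_lt_comap_of_surjective hf).2 hlt, ?_⟩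
  intro M hMn h1 h2
  have hker : f.ker ≤ M := (Subgroup.ker_le_comap f K).trans h1
  have hM' : (M.map f).comap f = M := Subgroup.comap_map_eq_self hker
  have h3 : K ≤ M.map f := by
    rw [← Subgroup.map_comap_eq_self_of_surjective hf K]
    exact Subgroup.map_mono h1
  have h4 : M.map f ≤ L := Subgroup.map_le_iff_le_comap.2 h2
  rcases hM (M.map f) (hMn.map f hf) h3 h4 with h5 | h5
  · left; rw [← h5, hM']
  · right; rw [← h5, hM']

theorem PPowerNormalizers.map {p : ℕ} {f : G →* H} (hf : Function.Surjective f) {I : Subgroup G}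
    (h : PPowerNormalizers p I) : PPowerNormalizers p (I.map f) := by
  intro K L hKL
  obtain ⟨k, hk⟩ := h _ _ (hKL.comap hf)
  refine ⟨k, ?_⟩
  rw [← Subgroup.index_comap_of_surjective _ hf, Subgroup.comap_normalizer_eq_of_surjective _ hf,
    ← hk, Subgroup.comap_inf]
  have h1 : (I.map f ⊔ K).comap f = I ⊔ K.comap f := by
    have h2 : I.map f ⊔ K = (I ⊔ K.comap f).map f := by
      rw [Subgroup.map_sup, Subgroup.map_comap_eq_self_of_surjective hf]
    rw [h2, Subgroup.comap_map_eq_self ((Subgroup.ker_le_comap f K).trans le_sup_right)]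
  rw [h1]

theorem IsPSupersoluble.of_surjective {p : ℕ} {f : G →* H} (hf : Function.Surjective f)
    (h : IsPSupersoluble p G) : IsPSupersoluble p H := by
  intro K L hK hKL
  have h1 := h (K.comap f) (L.comap f) (hKL.comap hf)
  rwa [card_factor, Subgroup.relIndex_comap, Subgroup.map_comap_eq_self_of_surjective hf,
    ← card_factor] at h1

theorem IsSupplement.map {X T : Subgroup G} (h : IsSupplement X T) {f : G →* H}
    (hf : Function.Surjective f) : IsSupplement (X.map f) (T.map f) := by
  intro g
  obtain ⟨g, rfl⟩ := hf g
  obtain ⟨x, hx, t, ht, rfl⟩ := h g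
  exact ⟨f x, Subgroup.mem_map_of_mem f hx, f t, Subgroup.mem_map_of_mem f ht, map_mul f x t⟩

/-- Because X contains the kernel, the intersection of the images of X and T is the image of X ∩ T;
this would fail for general X. -/
theorem HasGoodSupplement.map {p : ℕ} {f : G →* H} (hf : Function.Surjective f) {X : Subgroup G}
    (hX : f.ker ≤ X) (h : HasGoodSupplement p X) : HasGoodSupplement p (X.map f) := by
  obtain ⟨T, hT, h1⟩ := h
  refine ⟨T.map f, hT.map hf, ?_⟩
  rcases h1 with h1 | ⟨I, h1, h2, h3⟩
  · exact Or.inl (h1.of_surjective (f.subgroupMap_surjective T))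
  · refine Or.inr ⟨I.map f, ?_, Subgroup.map_mono h2, h3.map hf⟩
    rintro _ ⟨⟨x, hx, rfl⟩, t, ht, hxt⟩
    refine ⟨t, h1 ⟨?_, ht⟩, hxt⟩
    have : x⁻¹ * t ∈ f.ker := by rw [MonoidHom.mem_ker, map_mul, map_inv, hxt, inv_mul_cancel]
    simpa using X.mul_mem hx (hX this)

end Transfer

/-! ### Supplements and minimal normal subgroups -/

section Supplements

variable {G : Type u} [Group G]

theorem IsSupplement.exists_mul {X T W : Subgroup G} (h : IsSupplement X T) (hX : X ≤ W) {w : G}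
    (hw : w ∈ W) : ∃ x ∈ X, ∃ t ∈ T ⊓ W, w = x * t := by
  obtain ⟨x, hx, t, ht, rfl⟩ := h w
  refine ⟨x, hx, t, ⟨ht, ?_⟩, rfl⟩
  simpa using W.mul_mem (W.inv_mem (hX hx)) hw

theorem IsSupplement.le_of_le {X T W : Subgroup G} (h : IsSupplement X T) (hX : X ≤ W)
    (hT : T ⊓ W ≤ X) : W ≤ X := by
  intro w hw
  obtain ⟨x, hx, t, ht, rfl⟩ := h.exists_mul hX hw
  exact X.mul_mem hx (hT ht)

/-- A subgroup normalised by `P` and by a supplement of a subgroup of `P` is normal. -/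
theorem IsSupplement.normal {X T P Y : Subgroup G} (h : IsSupplement X T) (hX : X ≤ P)
    (hP : Normalizes P Y) (hT : Normalizes T Y) : Y.Normal := by
  refine ⟨fun y hy g => ?_⟩
  obtain ⟨x, hx, t, ht, rfl⟩ := h g
  have := hP x (hX hx) _ (hT t ht y hy)
  simpa [mul_assoc] using this

theorem card_le_mul_of_forall_exists [Finite G] {W X Y : Subgroup G}
    (h : ∀ w ∈ W, ∃ x ∈ X, ∃ y ∈ Y, w = x * y) : Nat.card W ≤ Nat.card X * Nat.card Y := by
  rw [← Nat.card_prod]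
  have h1 : Nat.card W ≤ Nat.card (Set.range fun z : X × Y => (z.1 : G) * z.2) := by
    refine Set.ncard_le_ncard ?_ (Set.toFinite _)
    intro w hw
    obtain ⟨x, hx, y, hy, rfl⟩ := h w hw
    exact ⟨(⟨x, hx⟩, ⟨y, hy⟩), rfl⟩
  exact h1.trans (Finite.card_range_le _)

theorem dvd_card_of_ne_bot [Finite G] {p : ℕ} (hp : p.Prime) {N : Subgroup G} (hN : IsPGroup p N)
    (hb : N ≠ ⊥) : p ∣ Nat.card N := by
  have : Fact p.Prime := ⟨hp⟩
  exact hN.card_eq_or_dvd.resolve_left fun h => hb (Subgroup.card_eq_one.1 h)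

/-- A minimal normal subgroup contained in a `p`-supersoluble supplement has order `p`. -/
theorem card_eq_of_le_pSupersoluble [Finite G] {p : ℕ} (hp : p.Prime) {N P X T : Subgroup G}
    (hN : IsChiefFactor ⊥ N) (hNp : IsPGroup p N) (hcomm : ∀ x ∈ P, ∀ n ∈ N, x * n = n * x)
    (hXP : X ≤ P) (hT : IsSupplement X T) (hNT : N ≤ T) (h : IsPSupersoluble p T) :
    Nat.card N = p := by
  have hNn := hN.2.1
  have h1 : IsChiefFactor (⊥ : Subgroup T) (N.subgroupOf T) := by
    refine ⟨inferInstance, inferInstance, ?_, ?_⟩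
    · rw [bot_lt_iff_ne_bot, Ne, Subgroup.subgroupOf_eq_bot, disjoint_iff, inf_eq_left.2 hNT]
      exact hN.2.2.1.ne'
    · intro M hM _ hMN
      have hMN' : M.map T.subtype ≤ N := by
        rintro _ ⟨x, hx, rfl⟩
        exact hMN hx
      -- P centralises N and G = XT with X ≤ P, so a normal subgroup of T inside N is normal in G;
      -- thus N stays minimal normal in T.
      have hMn : (M.map T.subtype).Normal := by
        refine hT.normal hXP (Normalizes.of_commute fun s hs x hx => hcomm s hs x (hMN' hx)) ?_
        rintro t ht _ ⟨x, hx, rfl⟩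
        exact ⟨⟨t, ht⟩ * x * ⟨t, ht⟩⁻¹, hM.conj_mem x hx _, rfl⟩
      rcases hN.2.2.2 _ hMn bot_le hMN' with h2 | h2
      · left
        rwa [Subgroup.map_eq_bot_iff_of_injective _ T.subtype_injective] at h2
      · right
        rw [← h2, Subgroup.subgroupOf, Subgroup.comap_map_eq_self_of_injective T.subtype_injective]
  have h2 := h _ _ h1
  rw [card_factor, Subgroup.relIndex_bot_left,
    Nat.card_congr (Subgroup.subgroupOfEquivOfLe hNT).toEquiv] at h2
  exact h2.resolve_left fun h3 => h3 (dvd_card_of_ne_bot hp hNp hN.2.2.1.ne')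

/-- Since N ≤ T, the subgroup I lying between X ∩ T and X satisfies I ∩ N = X ∩ N. Its normaliser
has p-power index and it is S-invariant, so it is normal and minimality of N applies. -/
theorem card_eq_or_inf_eq_bot_or_le [Finite G] {p : ℕ} (hp : p.Prime) (S : Sylow p G)
    {N P X T : Subgroup G} (hN : IsChiefFactor ⊥ N) (hNp : IsPGroup p N)
    (hcomm : ∀ x ∈ P, ∀ n ∈ N, x * n = n * x) (hXP : X ≤ P) (hT : IsSupplement X T) (hNT : N ≤ T)
    (h : IsPSupersoluble p T ∨ ∃ I : Subgroup G, X ⊓ T ≤ I ∧ I ≤ X ∧ PPowerNormalizers p I)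
    (hS : Normalizes (S : Subgroup G) (X ⊓ N)) : Nat.card N = p ∨ X ⊓ N = ⊥ ∨ N ≤ X := by
  rcases h with h | ⟨I, h1, h2, h3⟩
  · exact Or.inl (card_eq_of_le_pSupersoluble hp hN hNp hcomm hXP hT hNT h)
  · right
    obtain ⟨k, hk⟩ := h3 ⊥ N hN
    have h4 : (I ⊔ ⊥) ⊓ N = X ⊓ N := by
      rw [sup_bot_eq]
      exact le_antisymm (inf_le_inf_right N h2)
        (le_inf (le_trans (inf_le_inf_left X hNT) h1) inf_le_right)
    rw [h4] at hk
    have h5 := normal_of_normalizes_sylow hp S hk hS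
    rcases hN.2.2.2 _ h5 bot_le inf_le_right with h6 | h6
    · exact Or.inl h6
    · exact Or.inr (inf_eq_right.1 h6)

theorem centralMod_of_pSupersoluble [Finite G] {p : ℕ} (hp : p.Prime) {P : Subgroup G}
    (hPn : P.Normal) (hP : IsPGroup p P) (h : IsPSupersoluble p G) : CentralMod p ⊥ P := by
  have : Fact p.Prime := ⟨hp⟩
  refine centralMod_of_chief hp hPn hP fun K L hKL hLP => ?_
  have hK := hKL.1
  have h1 := h K L hKL
  rw [card_factor] at h1
  refine h1.resolve_left fun h2 => h2 ?_
  obtain ⟨n, hn⟩ := IsPGroup.iff_card.1 (hP.to_le hLP)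
  have h3 : K.relIndex L ∣ p ^ n := hn ▸ Subgroup.relIndex_dvd_card K L
  obtain ⟨j, -, hj⟩ := (Nat.dvd_prime_pow hp).1 h3
  rw [hj]
  refine dvd_pow_self p fun hj0 => ?_
  rw [hj0, pow_zero, Subgroup.relIndex_eq_one] at hj
  exact not_le_of_gt hKL.2.2.1 hj

theorem IsPSupersoluble.of_eq_top {p : ℕ} {T : Subgroup G} (hT : T = ⊤) (h : IsPSupersoluble p T) :
    IsPSupersoluble p G := by
  refine h.of_surjective (f := T.subtype) ?_
  rw [← MonoidHom.range_eq_top, Subgroup.range_subtype, hT]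

end Supplements

end PiSupp

namespace PiSupp

universe u

/-! ### Quaternion sections -/

section Quaternion

theorem exists_quaternion_hom {X : Type*} [Group X] {a b : X} (ha : a ^ 4 = 1) (ha2 : a ^ 2 ≠ 1)
    (hb : b ^ 2 = a ^ 2) (hab : a * b = b * a⁻¹) :
    ∃ f : QuaternionGroup 2 →* X, Function.Injective f := by
  let e : ZMod (2 * 2) →+ Additive X :=
    ZMod.lift (2 * 2) ⟨zmultiplesHom (Additive X) (Additive.ofMul a), by
      change (((2 * 2 : ℕ) : ℤ)) • Additive.ofMul a = 0
      rw [natCast_zsmul]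
      exact congrArg Additive.ofMul ha⟩
  let E : ZMod (2 * 2) → X := fun i => (e i).toMul
  have hE : ∀ n : ℤ, E n = a ^ n := by
    intro n
    change (e n).toMul = a ^ n
    rw [ZMod.lift_coe]
    rfl
  have hadd : ∀ i j, E (i + j) = E i * E j := fun i j => by
    change (e (i + j)).toMul = _
    rw [map_add]
    rfl
  have hb' : ∀ i, E i * b = b * E (-i) := by
    intro i
    obtain ⟨n, rfl⟩ := ZMod.intCast_surjective i
    rw [← Int.cast_neg, hE, hE]
    have h1 : SemiconjBy b a⁻¹ a := hab.symm
    have h2 := h1.zpow_right n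
    rw [inv_zpow'] at h2
    exact h2.eq.symm
  have hE2 : E 2 = b ^ 2 := by
    rw [hb]
    exact_mod_cast hE 2
  have h0 : E 0 = 1 := by simpa using hE 0
  let F : QuaternionGroup 2 → X
    | QuaternionGroup.a i => E i
    | QuaternionGroup.xa i => b * E i
  have hF : ∀ x y, F (x * y) = F x * F y := by
    rintro (i | i) (j | j)
    · rw [QuaternionGroup.a_mul_a]
      exact hadd i j
    · rw [QuaternionGroup.a_mul_xa]
      change b * E (j - i) = E i * (b * E j)
      rw [← mul_assoc, hb', mul_assoc, ← hadd, neg_add_eq_sub]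
    · rw [QuaternionGroup.xa_mul_a]
      change b * E (i + j) = b * E i * E j
      rw [hadd, mul_assoc]
    · rw [QuaternionGroup.xa_mul_xa]
      change E (((2 : ℕ) : ZMod (2 * 2)) + j - i) = b * E i * (b * E j)
      have h1 : b * E i * (b * E j) = b ^ 2 * E (-i + j) := by
        rw [hadd, sq, mul_assoc, ← mul_assoc (E i), hb']
        simp only [mul_assoc]
      have h2 : ((2 : ℕ) : ZMod (2 * 2)) + j - i = 2 + (-i + j) := by
        push_cast
        ring
      rw [h1, h2, hadd 2, hE2]
  refine ⟨MonoidHom.mk' F hF, ?_⟩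
  rw [injective_iff_map_eq_one]
  -- If b were a power of a it would commute with a, and the relation `hab` would give `a ^ 2 = 1`.
  have hba : ∀ i, b ≠ E i := by
    intro i hi
    have h1 := hb' 1
    rw [hi, ← hadd, ← hadd, add_comm] at h1
    have h2 : E 1 = a := by simpa using hE 1
    have h3 : E (1 + 1) = 1 := by
      have h4 := congrArg (fun t => (E i)⁻¹ * t * E 1) h1
      simp only [hadd, inv_mul_cancel_left] at h4
      rw [← hadd 1 1, ← hadd (-1) 1, neg_add_cancel, h0] at h4
      exact h4
    rw [hadd, h2, ← sq] at h3
    exact ha2 h3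
  rintro (i | i) hi
  · change E i = 1 at hi
    have key : ∀ n : ℤ, a ^ n = 1 → (4 : ℤ) ∣ n := by
      intro n hn
      have ho : orderOf a = 4 := orderOf_eq_prime_pow (p := 2) (n := 1) (by simpa using ha2) ha
      have := orderOf_dvd_iff_zpow_eq_one.2 hn
      rwa [ho] at this
    obtain ⟨n, rfl⟩ := ZMod.intCast_surjective i
    rw [hE] at hi
    have h5 : ((n : ℤ) : ZMod (2 * 2)) = 0 := (ZMod.intCast_zmod_eq_zero_iff_dvd n (2 * 2)).2 (key n hi)
    rw [h5]
    rfl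
  · exfalso
    change b * E i = 1 at hi
    refine hba (-i) (mul_right_cancel (b := E i) ?_)
    rw [hi, ← hadd, neg_add_cancel, h0]

/-- A subgroup of a quotient of a subgroup is again a section: pull the quaternion group back along
π and push it into X along j. -/
theorem IsQuaternionFree.false_of_section {X Y : Type u} [Group X] [Group Y] {Z : Type*} [Group Z]
    (h : IsQuaternionFree X) (j : Y →* X) (hj : Function.Injective j) (π : Y →* Z)
    (hπ : Function.Surjective π) (f : QuaternionGroup 2 →* Z) (hf : Function.Injective f) :
    False := by
  let W : Subgroup Y := f.range.comap π
  let φ : W →* f.range := (π.comp W.subtype).codRestrict f.range fun w => w.2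
  have hφ : Function.Surjective φ := by
    rintro ⟨z, hz⟩
    obtain ⟨y, rfl⟩ := hπ z
    exact ⟨⟨y, hz⟩, rfl⟩
  let e1 : W.map j ≃* W := (W.equivMapOfInjective j hj).symm
  let ψ : W.map j →* QuaternionGroup 2 :=
    ((MonoidHom.ofInjective hf).symm.toMonoidHom.comp φ).comp e1.toMonoidHom
  have hψ : Function.Surjective ψ :=
    ((MonoidHom.ofInjective hf).symm.surjective.comp hφ).comp e1.surjective
  exact (h (W.map j) ψ.ker).false (QuotientGroup.quotientKerEquivOfSurjective ψ hψ)

/-- The subgroup is {1, xy, xz, yz}. It identifies the three involutions, and the nontriviality of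
y, z and xyz is what keeps x outside it. -/
theorem exists_subgroup_of_involutions {C : Type*} [Group C] (hC : ∀ s t : C, s * t = t * s)
    {x y z : C} (hx : x * x = 1)
    (hy : y * y = 1) (hz : z * z = 1) (hx1 : x ≠ 1) (hy1 : y ≠ 1) (hz1 : z ≠ 1)
    (hxyz : x * y * z ≠ 1) : ∃ B : Subgroup C, x * y ∈ B ∧ x * z ∈ B ∧ x ∉ B := by
  let _ : CommGroup C := { ‹Group C› with mul_comm := hC }
  have hx' : ∀ t, x * (x * t) = t := fun t => by rw [← mul_assoc, hx, one_mul]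
  have hy' : ∀ t, y * (y * t) = t := fun t => by rw [← mul_assoc, hy, one_mul]
  refine ⟨{ carrier := {w | w = 1 ∨ w = x * y ∨ w = x * z ∨ w = y * z}
            one_mem' := Or.inl rfl
            mul_mem' := ?_
            inv_mem' := ?_ }, Or.inr (Or.inl rfl), Or.inr (Or.inr (Or.inl rfl)), ?_⟩
  · rintro _ _ (rfl | rfl | rfl | rfl) (rfl | rfl | rfl | rfl) <;>
      simp [mul_comm, mul_left_comm, hx, hy, hz, hx', hy']
  · have hinv : ∀ s t : C, s * s = 1 → t * t = 1 → (s * t)⁻¹ = s * t := fun s t hs ht => by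
      rw [inv_eq_iff_mul_eq_one, mul_mul_mul_comm, hs, ht, one_mul]
    rintro _ (rfl | rfl | rfl | rfl)
    · exact Or.inl inv_one
    · exact Or.inr (Or.inl (hinv x y hx hy))
    · exact Or.inr (Or.inr (Or.inl (hinv x z hx hz)))
    · exact Or.inr (Or.inr (Or.inr (hinv y z hy hz)))
  · rintro (h | h | h | h)
    · exact hx1 h
    · exact hy1 (left_eq_mul.1 h)
    · exact hz1 (left_eq_mul.1 h)
    · refine hxyz ?_
      rw [mul_assoc, ← h, hx]

/-- Two non-commuting elements `a`, `b` whose squares and commutator are central involutions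
generate a group with a quaternion quotient, provided `ab` is not an involution. -/
theorem exists_quaternion_section {Y : Type*} [Group Y] {a b z : Y} (hz : a * b = z * (b * a))
    (hac : a ^ 2 ∈ Subgroup.center Y) (hbc : b ^ 2 ∈ Subgroup.center Y)
    (hzc : z ∈ Subgroup.center Y) (ha4 : a ^ 4 = 1) (hb4 : b ^ 4 = 1) (hz2 : z ^ 2 = 1)
    (ha : a ^ 2 ≠ 1) (hb : b ^ 2 ≠ 1) (hz1 : z ≠ 1) (hab : (a * b) ^ 2 ≠ 1) :
    ∃ (B : Subgroup Y) (_ : B.Normal) (f : QuaternionGroup 2 →* Y ⧸ B), Function.Injective f := by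
  have hzcomm : ∀ g, g * z = z * g := Subgroup.mem_center_iff.1 hzc
  -- So the hypothesis that ab is not an involution says that the product of the three central
  -- involutions is nontrivial. Modulo the subgroup B they become one nontrivial element, as in the
  -- quaternion group.
  have hprod : (a * b) ^ 2 = z * (a ^ 2 * b ^ 2) := by
    have h1 : b * a = z * (a * b) := by rw [hz, ← mul_assoc, ← sq, hz2, one_mul]
    calc (a * b) ^ 2 = a * (b * a) * b := by rw [sq]; group
      _ = (a * z) * a * b * b := by rw [h1]; group
      _ = z * (a ^ 2 * b ^ 2) := by rw [hzcomm, sq, sq]; group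
  obtain ⟨B, h1, h2, h3⟩ := exists_subgroup_of_involutions (C := Subgroup.center Y)
    (fun s t => Subtype.ext (Subgroup.mem_center_iff.1 t.2 s))
    (x := ⟨a ^ 2, hac⟩) (y := ⟨b ^ 2, hbc⟩) (z := ⟨z, hzc⟩)
    (by ext; change a ^ 2 * a ^ 2 = 1; rw [← pow_add, ha4])
    (by ext; change b ^ 2 * b ^ 2 = 1; rw [← pow_add, hb4])
    (by ext; change z * z = 1; rw [← sq, hz2])
    (fun h => ha (congrArg Subtype.val h)) (fun h => hb (congrArg Subtype.val h))
    (fun h => hz1 (congrArg Subtype.val h))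
    (fun h => hab (by
      rw [hprod, ← hzcomm]
      exact congrArg Subtype.val h))
  let B' := B.map (Subgroup.center Y).subtype
  have hB' : ∀ w (hw : w ∈ Subgroup.center Y), w ∈ B' ↔ ⟨w, hw⟩ ∈ B := by
    intro w hw
    constructor
    · rintro ⟨w', hw', rfl⟩
      exact hw'
    · exact fun h => ⟨_, h, rfl⟩
  have hn : B'.Normal := by
    refine ⟨?_⟩
    rintro _ ⟨w, hw, rfl⟩ g
    have : g * (w : Y) * g⁻¹ = w := by
      rw [Subgroup.mem_center_iff.1 w.2 g, mul_inv_cancel_right]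
    change g * (w : Y) * g⁻¹ ∈ B'
    rw [this]
    exact ⟨w, hw, rfl⟩
  refine ⟨B', hn, exists_quaternion_hom (a := (a : Y ⧸ B')) (b := (b : Y ⧸ B')) ?_ ?_ ?_ ?_⟩
  · rw [← QuotientGroup.mk_pow, ha4, QuotientGroup.mk_one]
  · rw [← QuotientGroup.mk_pow, Ne, QuotientGroup.eq_one_iff, hB' _ hac]
    exact h3
  · rw [← QuotientGroup.mk_pow, ← QuotientGroup.mk_pow, eq_comm, QuotientGroup.eq]
    have : (a ^ 2)⁻¹ = a ^ 2 := by rw [inv_eq_iff_mul_eq_one, ← pow_add, ha4]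
    rw [this]
    exact (hB' _ (mul_mem hac hbc)).2 h1
  · rw [← QuotientGroup.mk_inv, ← QuotientGroup.mk_mul, ← QuotientGroup.mk_mul, eq_comm,
      QuotientGroup.eq]
    have : (b * a⁻¹)⁻¹ * (a * b) = a ^ 2 * z := by
      calc (b * a⁻¹)⁻¹ * (a * b) = (a * b⁻¹) * z * (b * a) := by rw [hz]; group
        _ = a ^ 2 * z := by rw [hzcomm (a * b⁻¹), hzcomm (a ^ 2), sq]; group
    rw [this]
    exact (hB' _ (mul_mem hac hzc)).2 h2

end Quaternion

end PiSupp

namespace PiSupp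

universe u

variable {G : Type u} [Group G]

/-! ### Cyclic subgroups when P is minimal non-centralised -/

section MinimalSubgroups

/-- If no proper normal subgroup `M` of `G` in `P` has `P/M` centralised, then a cyclic subgroup of
`P` has no proper supplement. -/
theorem IsSupplement.eq_top_of_zpowers [Finite G] {p : ℕ} (hp : p.Prime) {P T : Subgroup G} (hPn : P.Normal)
    (hP : IsPGroup p P) (hind : ∀ M : Subgroup G, M.Normal → M < P → ¬ CentralMod p M P) {x : G}
    (hx : x ∈ P) (hT : IsSupplement (Subgroup.zpowers x) T) : T = ⊤ := by
  have hxP : Subgroup.zpowers x ≤ P := (Subgroup.zpowers_le).2 hx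
  by_contra hne
  have hlt : T ⊓ P < P := by
    refine lt_of_le_of_ne inf_le_right fun h => hne ?_
    rw [Subgroup.eq_top_iff']
    intro g
    obtain ⟨y, hy, t, ht, rfl⟩ := hT g
    exact T.mul_mem (inf_eq_right.1 h (hxP hy)) ht
  have hlt' := sup_powComm_lt hp hP hlt
  -- Adding the Frattini subgroup makes M normalised by P while keeping it proper. Then P is
  -- generated by M and x with x ^ p in M, so |P : M| = p, making P/M central against `hind`.
  set M := T ⊓ P ⊔ powComm p P with hM
  have hPM : Normalizes P M := by
    intro s hs m hm
    have h1 : s * m * s⁻¹ * m⁻¹ ∈ M := Subgroup.mem_sup_right (comm_mem_powComm hs (hlt'.le hm))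
    simpa using M.mul_mem h1 hm
  have hMn : M.Normal := by
    refine hT.normal hxP hPM (Normalizes.sup ?_ (normalizes_of_normal T (powComm_normal p hPn)))
    exact (Normalizes.self T).inf (normalizes_of_normal T hPn)
  have hle : P ≤ Subgroup.zpowers x ⊔ M := by
    intro w hw
    obtain ⟨y, hy, t, ht, rfl⟩ := hT.exists_mul hxP hw
    exact mul_mem (Subgroup.mem_sup_left hy) (Subgroup.mem_sup_right (Subgroup.mem_sup_left ht))
  have hPeq : Subgroup.zpowers x ⊔ M = P := le_antisymm (sup_le hxP hlt'.le) hle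
  have hxM : x ∉ M := fun h => by
    rw [sup_eq_right.2 ((Subgroup.zpowers_le).2 h)] at hPeq
    exact hlt'.ne hPeq
  have h1 := relIndex_zpowers_of_pow_mem hp hxM (Subgroup.mem_sup_right (pow_mem_powComm hx))
    (normalizes_of_normal _ hMn)
  rw [hPeq] at h1
  exact hind M hMn hlt' (centralMod_of_relIndex_eq hp h1)

/-- The supplement must be G itself. A p-supersoluble G would centralise P in the sense of
`CentralMod`, so the other alternative holds, and there I is squeezed to the whole cyclic subgroup.
-/
theorem HasGoodSupplement.pPowerNormalizers [Finite G] {p : ℕ} (hp : p.Prime) {P : Subgroup G}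
    (hPn : P.Normal) (hP : IsPGroup p P)
    (hind : ∀ M : Subgroup G, M.Normal → M < P → ¬ CentralMod p M P)
    (hnot : ¬ CentralMod p ⊥ P) {x : G} (hx : x ∈ P)
    (h : HasGoodSupplement p (Subgroup.zpowers x)) : PPowerNormalizers p (Subgroup.zpowers x) := by
  obtain ⟨T, hT, h1⟩ := h
  have hTt := hT.eq_top_of_zpowers hp hPn hP hind hx
  rcases h1 with h1 | ⟨I, h1, h2, h3⟩
  · exact absurd (centralMod_of_pSupersoluble hp hPn hP (h1.of_eq_top hTt)) hnot
  · rw [hTt, inf_top_eq] at h1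
    rwa [le_antisymm h1 h2]

/-- The subgroup generated by the commutators of elements of `P` with the elements of the residual
of prime power order for primes other than `p`. -/
def residualCommutator (p : ℕ) (P : Subgroup G) : Subgroup G :=
  Subgroup.closure {z | ∃ g ∈ residual p G, IsPrimaryCoprime p g ∧ ∃ x ∈ P,
    z = x⁻¹ * (g * x * g⁻¹)}

/-- This commutator subgroup is normal and P is centralised modulo it, so by `hind` it cannot be
proper. -/
theorem residualCommutator_eq {p : ℕ} {P : Subgroup G} (hPn : P.Normal)
    (hind : ∀ M : Subgroup G, M.Normal → M < P → ¬ CentralMod p M P) :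
    residualCommutator p P = P := by
  by_contra hne
  refine hind _ ?_ (lt_of_le_of_ne ?_ hne) ?_
  · refine normal_of_normalizes_top (normalizes_closure ?_)
    rintro s - _ ⟨g, hg, hg', x, hx, rfl⟩
    refine Subgroup.subset_closure ⟨s * g * s⁻¹, (residual_normal p).conj_mem g hg s, hg'.conj s,
      s * x * s⁻¹, hPn.conj_mem x hx s, ?_⟩
    group
  · rw [residualCommutator, Subgroup.closure_le]
    rintro _ ⟨g, -, -, x, hx, rfl⟩
    exact P.mul_mem (P.inv_mem hx) (hPn.conj_mem x hx g)
  · exact fun g hg hg' x hx => Subgroup.subset_closure ⟨g, hg, hg', x, hx, rfl⟩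

/-- A three subgroups argument: g fixes both r and its conjugate by x, since R is normal. Hence the
commutators of g with P, which generate P, commute with R. -/
theorem commute_of_centralMod {p : ℕ} {P R : Subgroup G} (hD : residualCommutator p P = P)
    (hRn : R.Normal) (hR : CentralMod p ⊥ R) : ∀ x ∈ P, ∀ r ∈ R, x * r = r * x := by
  rw [centralMod_bot_iff] at hR
  intro x hx r hr
  rw [← hD] at hx
  revert r
  induction hx using Subgroup.closure_induction with
  | mem z hz =>
    obtain ⟨g, hg, hg', x, hx, rfl⟩ := hz
    intro r hr
    have h1 := hR g hg hg' r hr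
    have h2 := hR g hg hg' _ (hRn.conj_mem r hr x)
    calc x⁻¹ * (g * x * g⁻¹) * r = x⁻¹ * g * x * g⁻¹ * (r * g) * g⁻¹ := by group
      _ = x⁻¹ * (g * (x * r * x⁻¹)) * x * g⁻¹ := by rw [← h1]; group
      _ = r * (x⁻¹ * (g * x * g⁻¹)) := by rw [h2]; group
  | one => simp
  | mul a b _ _ ha hb =>
    intro r hr
    rw [mul_assoc, hb r hr, ← mul_assoc, ha r hr, mul_assoc]
  | inv a _ ha =>
    intro r hr
    exact (Commute.inv_left (ha r hr)).eq

/-- If `x ↦ x ^ e` is multiplicative on `P` with values in a centralised subgroup, then `P` has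
exponent dividing `e`. -/
theorem pow_eq_one_of_residualCommutator {p e : ℕ} {P R : Subgroup G} (hPn : P.Normal)
    (hD : residualCommutator p P = P)
    (hR : CentralMod p ⊥ R) (hmul : ∀ x ∈ P, ∀ y ∈ P, (x * y) ^ e = x ^ e * y ^ e)
    (hpow : ∀ x ∈ P, x ^ e ∈ R) : ∀ x ∈ P, x ^ e = 1 := by
  rw [centralMod_bot_iff] at hR
  intro x hx
  rw [← hD] at hx
  have key : x ∈ P ∧ x ^ e = 1 := by
    induction hx using Subgroup.closure_induction with
    | mem z hz =>
      obtain ⟨g, hg, hg', x, hx, rfl⟩ := hz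
      refine ⟨P.mul_mem (P.inv_mem hx) (hPn.conj_mem x hx g), ?_⟩
      rw [hmul _ (P.inv_mem hx) _ (hPn.conj_mem x hx g), conj_pow, hR g hg hg' _ (hpow x hx),
        mul_inv_cancel_right, inv_pow, inv_mul_cancel]
    | one => exact ⟨P.one_mem, one_pow e⟩
    | mul a b _ _ ha hb =>
      exact ⟨P.mul_mem ha.1 hb.1, by rw [hmul a ha.1 b hb.1, ha.2, hb.2, one_mul]⟩
    | inv a _ ha => exact ⟨P.inv_mem ha.1, by rw [inv_pow, ha.2, inv_one]⟩
  exact key.2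

theorem mul_pow_of_commutator_central {x y z : G} (h : y * x = x * y * z) (hzx : z * x = x * z)
    (hzy : z * y = y * z) (n : ℕ) :
    y ^ n * x = x * y ^ n * z ^ n ∧ (x * y) ^ n = x ^ n * y ^ n * z ^ (n.choose 2) := by
  have hx : Commute z x := hzx
  have hy : Commute z y := hzy
  have h1 : ∀ n : ℕ, y ^ n * x = x * y ^ n * z ^ n := by
    intro n
    induction n with
    | zero => simp
    | succ n ih =>
      calc y ^ (n + 1) * x = y ^ n * (y * x) := by rw [pow_succ, mul_assoc]
        _ = y ^ n * x * y * z := by rw [h]; simp only [mul_assoc]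
        _ = x * y ^ n * (z ^ n * y) * z := by rw [ih]; simp only [mul_assoc]
        _ = x * y ^ (n + 1) * z ^ (n + 1) := by
          rw [(hy.pow_left n).eq, pow_succ, pow_succ]; simp only [mul_assoc]
  refine ⟨h1 n, ?_⟩
  induction n with
  | zero => simp
  | succ n ih =>
    have hc : (n + 1).choose 2 = n + n.choose 2 := by
      rw [Nat.choose_succ_succ, Nat.choose_one_right]
    have h2 : Commute (z ^ n.choose 2) (x * y) := (hx.mul_right hy).pow_left _
    have h3 : Commute (z ^ n) y := hy.pow_left n
    calc (x * y) ^ (n + 1) = x ^ n * y ^ n * (z ^ n.choose 2 * (x * y)) := by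
          rw [pow_succ, ih, mul_assoc]
      _ = x ^ n * (y ^ n * x) * y * z ^ n.choose 2 := by rw [h2.eq]; simp only [mul_assoc]
      _ = x ^ n * x * y ^ n * (z ^ n * y) * z ^ n.choose 2 := by rw [h1]; simp only [mul_assoc]
      _ = x ^ (n + 1) * y ^ (n + 1) * z ^ (n + 1).choose 2 := by
          rw [h3.eq, hc, pow_add z, pow_succ x, pow_succ y]; simp only [mul_assoc]

/-- The power map is multiplicative on `p`-groups of class two. -/
theorem mul_pow_of_class_two {p e : ℕ} {P R : Subgroup G}
    (hc : ∀ x ∈ P, ∀ r ∈ R, x * r = r * x) (hΦ : powComm p P ≤ R)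
    (he : p ∣ e.choose 2) : ∀ x ∈ P, ∀ y ∈ P, (x * y) ^ e = x ^ e * y ^ e := by
  intro x hx y hy
  -- The commutator of the inverses, written in the shape that `comm_mem_powComm` provides. Its p-th
  -- power is trivial because `y ^ p` lies in R and so commutes with x.
  set z := y⁻¹ * x⁻¹ * (y⁻¹)⁻¹ * (x⁻¹)⁻¹ with hz
  have hzR : z ∈ R := hΦ (comm_mem_powComm (P.inv_mem hy) (P.inv_mem hx))
  have h : y * x = x * y * z := by rw [hz]; group
  obtain ⟨h1, -⟩ := mul_pow_of_commutator_central h (hc x hx z hzR).symm (hc y hy z hzR).symm p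
  obtain ⟨-, h2⟩ := mul_pow_of_commutator_central h (hc x hx z hzR).symm (hc y hy z hzR).symm e
  have hzp : z ^ p = 1 := by
    rw [← hc x hx _ (hΦ (pow_mem_powComm hy)), left_eq_mul] at h1
    exact h1
  obtain ⟨c, hc'⟩ := he
  rw [h2, hc', pow_mul, hzp, one_pow, mul_one]

/-- In a chief factor `P/R` of `p`-power order, cyclic subgroups whose normalisers have `p`-power
index avoid the Sylow-invariant maximal subgroups. -/
theorem PPowerNormalizers.notMem [Finite G] {p : ℕ} (hp : p.Prime) (S : Sylow p G) {P R U : Subgroup G}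
    (hch : IsChiefFactor R P) (hRU : R ≤ U) (hUP : U < P) (hU : Normalizes (S : Subgroup G) U)
    {x : G} (hx : x ∈ P) (hxR : x ∉ R) (h : PPowerNormalizers p (Subgroup.zpowers x)) : x ∉ U := by
  intro hxU
  have hRn := hch.1
  have hPn := hch.2.1
  obtain ⟨k, hk⟩ := h R P hch
  have hXP : (Subgroup.zpowers x ⊔ R) ⊓ P = Subgroup.zpowers x ⊔ R :=
    inf_eq_left.2 (sup_le ((Subgroup.zpowers_le).2 hx) hch.2.2.1.le)
  rw [hXP] at hk
  have hXU : Subgroup.zpowers x ⊔ R ≤ U := sup_le ((Subgroup.zpowers_le).2 hxU) hRU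
  have hconj : ∀ g : G, g * x * g⁻¹ ∈ U := by
    intro g
    obtain ⟨s, hs, n, hn, rfl⟩ := mem_mul_sylow hp S hk g
    have h1 := (Subgroup.mem_normalizer_iff.1 hn x).1
      (Subgroup.mem_sup_left (Subgroup.mem_zpowers x))
    have h2 := hU s hs _ (hXU h1)
    simpa [mul_assoc] using h2
  have hW : Subgroup.normalClosure {x} ≤ U := by
    rw [Subgroup.normalClosure, Subgroup.closure_le]
    intro y hy
    obtain ⟨a, ha, hay⟩ := Group.mem_conjugatesOfSet_iff.1 hy
    rw [Set.mem_singleton_iff] at ha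
    subst ha
    obtain ⟨c, rfl⟩ := isConj_iff.1 hay
    exact hconj c
  have hle : Subgroup.normalClosure {x} ⊔ R ≤ U := sup_le hW hRU
  have hxW : x ∈ Subgroup.normalClosure {x} ⊔ R :=
    Subgroup.mem_sup_left (Subgroup.subset_normalClosure rfl)
  rcases hch.2.2.2 _ inferInstance le_sup_right (hle.trans hUP.le) with h1 | h1
  · exact hxR (h1 ▸ hxW)
  · exact hUP.not_ge (h1 ▸ hle)

/-- The case of a chief factor all of whose elements are represented by elements generating cyclic
subgroups with `p`-power normaliser indices. -/
theorem relIndex_eq_of_forall_pPowerNormalizers [Finite G] {p : ℕ} (hp : p.Prime) {P R : Subgroup G}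
    (hP : IsPGroup p P) (hch : IsChiefFactor R P)
    (h : ∀ x ∈ P, x ∉ R → PPowerNormalizers p (Subgroup.zpowers x)) : R.relIndex P = p := by
  have : Fact p.Prime := ⟨hp⟩
  have hPn := hch.2.1
  let S : Sylow p G := default
  obtain ⟨U, h1, h2, h3, h4⟩ := exists_normalizes_relIndex hp S.isPGroup' (hP.le_sylow_of_normal S)
    hch.2.2.1 (normalizes_of_normal _ hch.1) (normalizes_of_normal _ hPn)
  have hUP : U < P := by
    refine lt_of_le_of_ne h2 ?_
    rintro rfl
    rw [Subgroup.relIndex_self] at h4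
    exact hp.one_lt.ne h4
  have hUR : U = R := by
    refine le_antisymm (fun x hx => ?_) h1
    by_contra hxR
    exact (h x (h2 hx) hxR).notMem hp S hch h1 hUP h3 (h2 hx) hxR hx
  rwa [hUR] at h4

/-- The case `p = 2` with an involution outside `R`. -/
theorem relIndex_eq_two_of_involution [Finite G] {P R : Subgroup G}
    (hP : IsPGroup 2 P) (hch : IsChiefFactor R P)
    (h : ∀ x ∈ P, x ∉ R → x ^ 2 = 1 → PPowerNormalizers 2 (Subgroup.zpowers x)) {x : G}
    (hx : x ∈ P) (hxR : x ∉ R) (hx2 : x ^ 2 = 1) : R.relIndex P = 2 := by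
  have hp := Nat.prime_two
  have : Fact (Nat.Prime 2) := ⟨hp⟩
  have hRn := hch.1
  have hPn := hch.2.1
  let S : Sylow 2 G := default
  obtain ⟨U, h1, h2, h3, h4⟩ := exists_normalizes_relIndex hp S.isPGroup' (hP.le_sylow_of_normal S)
    hch.2.2.1 (normalizes_of_normal _ hch.1) (normalizes_of_normal _ hPn)
  have hUP : U < P := by
    refine lt_of_le_of_ne h2 ?_
    rintro rfl
    rw [Subgroup.relIndex_self] at h4
    exact hp.one_lt.ne h4
  have hconjR : ∀ g : G, g * x * g⁻¹ ∉ R := fun g hg => hxR (by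
    have := hRn.conj_mem _ hg g⁻¹
    simpa [mul_assoc] using this)
  have hconjU : ∀ g : G, g * x * g⁻¹ ∉ U := fun g => by
    refine (h _ (hPn.conj_mem x hx g) (hconjR g) ?_).notMem hp S hch h1 hUP h3
      (hPn.conj_mem x hx g) (hconjR g)
    rw [conj_pow, hx2, mul_one, mul_inv_cancel]
  -- All conjugates of x lie in the one nontrivial coset of U in P. Hence W lies in U, and being
  -- normal, in R; so x is central modulo R and generates P with it.
  have hdiff : ∀ g k : G, (g * x * g⁻¹) * (k * x * k⁻¹)⁻¹ ∈ U := by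
    intro g k
    have h5 : (U.subgroupOf P).index = 2 := h4
    have h6 := Subgroup.mul_mem_iff_of_index_two h5 (a := ⟨g * x * g⁻¹, hPn.conj_mem x hx g⟩)
      (b := ⟨k * x * k⁻¹, hPn.conj_mem x hx k⟩⁻¹)
    rw [inv_mem_iff] at h6
    exact h6.2 ⟨fun h => absurd h (hconjU g), fun h => absurd h (hconjU k)⟩
  let W := Subgroup.closure {z | ∃ g k : G, z = (g * x * g⁻¹) * (k * x * k⁻¹)⁻¹}
  have hWn : W.Normal := by
    refine normal_of_normalizes_top (normalizes_closure ?_)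
    rintro s - _ ⟨g, k, rfl⟩
    refine Subgroup.subset_closure ⟨s * g, s * k, ?_⟩
    group
  have hWU : W ⊔ R ≤ U := by
    refine sup_le ?_ h1
    rw [Subgroup.closure_le]
    rintro _ ⟨g, k, rfl⟩
    exact hdiff g k
  have hWR : W ≤ R := by
    rcases hch.2.2.2 _ inferInstance le_sup_right (hWU.trans h2) with h5 | h5
    · exact h5 ▸ le_sup_left
    · exact absurd (h5 ▸ hWU) hUP.not_ge
  have hXn : (Subgroup.zpowers x ⊔ R).Normal := by
    refine normal_of_normalizes_top (normalizes_iff_map_le.2 fun g _ => ?_)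
    rw [Subgroup.map_sup, MonoidHom.map_zpowers]
    refine sup_le ((Subgroup.zpowers_le).2 ?_)
      ((normalizes_iff_map_le.1 (normalizes_of_normal ⊤ hRn) g trivial).trans le_sup_right)
    have h5 : g * x * g⁻¹ * (1 * x * 1⁻¹)⁻¹ ∈ R := hWR (Subgroup.subset_closure ⟨g, 1, rfl⟩)
    rw [one_mul, inv_one, mul_one] at h5
    have h6 := (Subgroup.zpowers x ⊔ R).mul_mem (Subgroup.mem_sup_right h5)
      (Subgroup.mem_sup_left (Subgroup.mem_zpowers x))
    rwa [inv_mul_cancel_right] at h6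
  have hXP : Subgroup.zpowers x ⊔ R = P := by
    refine (hch.2.2.2 _ hXn le_sup_right
      (sup_le ((Subgroup.zpowers_le).2 hx) hch.2.2.1.le)).resolve_left fun h5 => hxR ?_
    rw [← h5]
    exact Subgroup.mem_sup_left (Subgroup.mem_zpowers x)
  rw [← hXP]
  exact relIndex_zpowers_of_pow_mem hp hxR (hx2 ▸ R.one_mem) (normalizes_of_normal _ hRn)

end MinimalSubgroups

end PiSupp

/-! ### The case of trivial D -/

namespace PiSupp

universe u

variable {G : Type u} [Group G]

/-- A quaternion-free `2`-group that is not centralised, of exponent four and with `R` the largest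
proper normal subgroup, has an involution outside `R`. -/
theorem exists_involution_of_quaternionFree {P₀ P R : Subgroup G} (hQ : IsQuaternionFree P₀)
    (hPP₀ : P ≤ P₀) (hPn : P.Normal) (hRP : R < P) (hc : ∀ x ∈ P, ∀ r ∈ R, x * r = r * x)
    (hΦ : powComm 2 P ≤ R) (hD : residualCommutator 2 P = P) (hR : CentralMod 2 ⊥ R)
    (h4 : ∀ x ∈ P, x ^ 4 = 1) : ∃ x ∈ P, x ∉ R ∧ x ^ 2 = 1 := by
  by_contra! hno
  by_cases hab : ∀ a ∈ P, ∀ b ∈ P, a * b = b * a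
  · have h2 := pow_eq_one_of_residualCommutator (e := 2) hPn hD hR
      (fun x hx y hy => Commute.mul_pow (hab x hx y hy) 2) (fun x hx => hΦ (pow_mem_powComm hx))
    obtain ⟨x, hx, hxR⟩ := SetLike.exists_of_lt hRP
    exact hno x hx hxR (h2 x hx)
  · push Not at hab
    obtain ⟨a, ha, b, hb, hne⟩ := hab
    have haR : a ∉ R := fun h => hne (hc b hb a h).symm
    have hbR : b ∉ R := fun h => hne (hc a ha b h)
    have habR : a * b ∉ R := fun h => hne (by
      have := hc b hb _ h
      rw [← mul_assoc] at this
      exact (mul_right_cancel this).symm)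
    have hcen : ∀ (w : P), (w : G) ∈ R → w ∈ Subgroup.center P := fun w hw =>
      Subgroup.mem_center_iff.2 fun g => Subtype.ext (hc g g.2 w hw)
    set z : P := ⟨a, ha⟩ * ⟨b, hb⟩ * ⟨a, ha⟩⁻¹ * ⟨b, hb⟩⁻¹ with hz
    have hzR : (z : G) ∈ R := hΦ (comm_mem_powComm ha hb)
    obtain ⟨B, hB, f, hf⟩ := exists_quaternion_section (Y := P) (a := ⟨a, ha⟩) (b := ⟨b, hb⟩)
      (z := z) (by rw [hz]; group) (hcen _ (hΦ (pow_mem_powComm ha)))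
      (hcen _ (hΦ (pow_mem_powComm hb))) (hcen _ hzR) (Subtype.ext (h4 a ha))
      (Subtype.ext (h4 b hb)) (by
        have h1 : (⟨a, ha⟩ * ⟨b, hb⟩ : P) = ⟨b, hb⟩ * ⟨a, ha⟩ * z := by
          rw [Subgroup.mem_center_iff.1 (hcen _ hzR), hz]
          group
        have hzc := Subgroup.mem_center_iff.1 (hcen _ hzR)
        obtain ⟨h2, -⟩ := mul_pow_of_commutator_central h1 (hzc ⟨b, hb⟩).symm
          (hzc ⟨a, ha⟩).symm 2
        have h3 : (⟨a, ha⟩ ^ 2 : P) ∈ Subgroup.center P := hcen _ (hΦ (pow_mem_powComm ha))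
        rw [← Subgroup.mem_center_iff.1 h3, left_eq_mul] at h2
        exact h2)
      (fun h => hno a ha haR (congrArg Subtype.val h))
      (fun h => hno b hb hbR (congrArg Subtype.val h))
      (fun h => hne (by
        rw [hz, mul_inv_eq_one, mul_inv_eq_iff_eq_mul] at h
        exact congrArg Subtype.val h))
      (fun h => hno _ (P.mul_mem ha hb) habR (congrArg Subtype.val h))
    exact hQ.false_of_section (Subgroup.inclusion hPP₀) (Subgroup.inclusion_injective hPP₀)
      (QuotientGroup.mk' B) (QuotientGroup.mk'_surjective B) f hf

/-- Let `P₀` be a `p`-subgroup all of whose subgroups of order `p` have good supplements; if `p = 2`,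
suppose that `P₀` is quaternion-free or that the same holds for cyclic subgroups of order `4`. Then
the normal subgroups of `G` in `P₀` are centralised by the residual `p'`-elements. -/
theorem centralMod_of_minimal_subgroups [Finite G] {p : ℕ} (hp : p.Prime) {P₀ : Subgroup G}
    (hP₀ : IsPGroup p P₀)
    (h1 : ∀ x ∈ P₀, orderOf x = p → HasGoodSupplement p (Subgroup.zpowers x))
    (h2 : p = 2 → IsQuaternionFree P₀ ∨
      ∀ x ∈ P₀, orderOf x = 4 → HasGoodSupplement p (Subgroup.zpowers x))
    (P : Subgroup G) (hPn : P.Normal) (hPP₀ : P ≤ P₀) : CentralMod p ⊥ P := by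
  have : Fact p.Prime := ⟨hp⟩
  induction hn : Nat.card P using Nat.strong_induction_on generalizing P with
  | _ n ih =>
    by_contra hnot
    have hP := hP₀.to_le hPP₀
    have hsub : ∀ M : Subgroup G, M.Normal → M < P → CentralMod p ⊥ M := fun M hM hMP =>
      ih _ (hn ▸ card_lt_card_of_lt hMP) M hM (hMP.le.trans hPP₀) rfl
    have hind : ∀ M : Subgroup G, M.Normal → M < P → ¬ CentralMod p M P := fun M hM hMP h =>
      hnot ((hsub M hM hMP).trans hp hP hMP.le h)
    have hb : P ≠ ⊥ := by
      rintro rfl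
      refine hnot (centralMod_bot_iff.2 fun g _ _ x hx => ?_)
      rw [Subgroup.mem_bot.1 hx, mul_one, one_mul]
    obtain ⟨R, hch⟩ := exists_maximal_normal hPn hb
    have hRn := hch.1
    have hRP := hch.2.2.1
    have hD := residualCommutator_eq hPn hind
    have hRc := hsub R hRn hRP
    have hcomm := commute_of_centralMod hD hRn hRc
    have hindex : R.relIndex P ≠ p := fun h => hind R hRn hRP (centralMod_of_relIndex_eq hp h)
    -- R together with the Frattini subgroup is a proper normal subgroup containing R, hence equal
    -- to R.
    have hΦ : powComm p P ≤ R := by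
      have hlt := sup_powComm_lt hp hP hRP
      have := powComm_normal p hPn
      rcases hch.2.2.2 _ inferInstance le_sup_left hlt.le with h | h
      · exact h ▸ le_sup_right
      · exact absurd h hlt.ne
    have hgood : ∀ x ∈ P, HasGoodSupplement p (Subgroup.zpowers x) →
        PPowerNormalizers p (Subgroup.zpowers x) := fun x hx h =>
      h.pPowerNormalizers hp hPn hP hind hnot hx
    -- Used with e = p for odd p and with e = 4 for p = 2, where 2 divides `Nat.choose 4 2` but not
    -- `Nat.choose 2 2`.
    have hexp : ∀ e : ℕ, p ∣ e.choose 2 → p ∣ e → ∀ x ∈ P, x ^ e = 1 := by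
      rintro e he ⟨c, rfl⟩
      refine pow_eq_one_of_residualCommutator hPn hD hRc (mul_pow_of_class_two hcomm hΦ he) ?_
      intro x hx
      rw [pow_mul]
      exact R.pow_mem (hΦ (pow_mem_powComm hx)) c
    have hord : ∀ x ∈ P, x ∉ R → x ^ p = 1 → PPowerNormalizers p (Subgroup.zpowers x) := by
      intro x hx hxR hxp
      refine hgood x hx (h1 x (hPP₀ hx) (orderOf_eq_prime hxp ?_))
      rintro rfl
      exact hxR R.one_mem
    by_cases hp2 : p = 2
    · subst hp2
      have h4 := hexp 4 (by decide) (by decide)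
      rcases h2 rfl with hQ | h2
      · obtain ⟨x, hx, hxR, hx2⟩ :=
          exists_involution_of_quaternionFree hQ hPP₀ hPn hRP hcomm hΦ hD hRc h4
        exact hindex (relIndex_eq_two_of_involution hP hch hord hx hxR hx2)
      · refine hindex (relIndex_eq_of_forall_pPowerNormalizers hp hP hch fun x hx hxR => ?_)
        by_cases hx2 : x ^ 2 = 1
        · exact hord x hx hxR hx2
        · refine hgood x hx (h2 x (hPP₀ hx) ?_)
          exact orderOf_eq_prime_pow (p := 2) (n := 1) (by simpa using hx2) (h4 x hx)
    · have hpe := hexp p (hp.dvd_choose_self (by norm_num)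
        (lt_of_le_of_ne hp.two_le (Ne.symm hp2))) dvd_rfl
      exact hindex (relIndex_eq_of_forall_pPowerNormalizers hp hP hch fun x hx hxR =>
        hord x hx hxR (hpe x hx))

end PiSupp

/-! ### The case of nontrivial D -/

namespace PiSupp

universe u

variable {G : Type u} [Group G]

theorem isQuaternionFree_of_card_lt {X : Type u} [Group X] [Finite X] (h : Nat.card X < 8) :
    IsQuaternionFree X := by
  refine fun A B hB => ⟨fun e => ?_⟩
  have h1 : Nat.card (A ⧸ B) = 8 := by
    rw [Nat.card_congr e.toEquiv, Nat.card_eq_fintype_card, QuaternionGroup.card]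
  have h2 : Nat.card (A ⧸ B) ≤ Nat.card A :=
    Nat.card_le_card_of_surjective _ (QuotientGroup.mk'_surjective B)
  have h3 : Nat.card A ≤ Nat.card X := Nat.card_le_card_of_injective _ A.subtype_injective
  omega

theorem card_comap_mk' (N : Subgroup G) [N.Normal] (X : Subgroup (G ⧸ N)) :
    Nat.card (X.comap (QuotientGroup.mk' N)) = Nat.card N * Nat.card X := by
  have h1 : N ≤ X.comap (QuotientGroup.mk' N) := by
    have := Subgroup.ker_le_comap (QuotientGroup.mk' N) X
    rwa [QuotientGroup.ker_mk'] at this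
  have h2 := Subgroup.relIndex_ker (K := X.comap (QuotientGroup.mk' N)) (QuotientGroup.mk' N)
  rw [QuotientGroup.ker_mk',
    Subgroup.map_comap_eq_self_of_surjective (QuotientGroup.mk'_surjective N)] at h2
  rw [← card_mul_relIndex h1, h2]

variable [Finite G] {p : ℕ}

/-- A supplement containing the minimal normal subgroup `N` is impossible when the supplemented
subgroup meets `N` in a Sylow-invariant subgroup of index `p` and `|N| > p`. -/
theorem not_le_of_relIndex_prime (hp : p.Prime) (S : Sylow p G) {N P X T N₁ : Subgroup G}
    (hN : IsChiefFactor ⊥ N) (hNp : IsPGroup p N) (hcomm : ∀ x ∈ P, ∀ n ∈ N, x * n = n * x)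
    (hXP : X ≤ P) (hT : IsSupplement X T)
    (h : IsPSupersoluble p T ∨ ∃ I : Subgroup G, X ⊓ T ≤ I ∧ I ≤ X ∧ PPowerNormalizers p I)
    (hXN : X ⊓ N = N₁) (hS : Normalizes (S : Subgroup G) N₁) (hidx : N₁.relIndex N = p)
    (hcard : Nat.card N ≠ p) : ¬ N ≤ T := by
  subst hXN
  intro hNT
  rcases card_eq_or_inf_eq_bot_or_le hp S hN hNp hcomm hXP hT hNT h hS with h1 | h1 | h1
  · exact hcard h1
  · rw [h1, Subgroup.relIndex_bot_left] at hidx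
    exact hcard hidx
  · rw [inf_eq_right.2 h1, Subgroup.relIndex_self] at hidx
    exact hp.one_lt.ne hidx

/-- If the subgroups of order `p ^ a` of `P` have good supplements, then minimal normal subgroups
in `P` have order at most `p ^ a`. -/
theorem card_minimal_normal_le (hp : p.Prime) {a : ℕ} (ha : 1 ≤ a) {P N : Subgroup G}
    (hPn : P.Normal) (hP : IsPGroup p P)
    (hgood : ∀ X : Subgroup G, X < P → Nat.card X = p ^ a → HasGoodSupplement p X)
    (hN : IsChiefFactor ⊥ N) (hNP : N ≤ P) : Nat.card N ≤ p ^ a := by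
  have : Fact p.Prime := ⟨hp⟩
  by_contra! hlt
  let S : Sylow p G := default
  have hPS : P ≤ S := hP.le_sylow_of_normal S
  have hNn := hN.2.1
  have hcomm := commute_of_minimal_normal hp hPn hP hN hNP
  obtain ⟨U, -, hUN, hUS, hUc⟩ := exists_normalizes_card_eq hp S.isPGroup' (hNP.trans hPS) bot_le
    (normalizes_of_normal _ inferInstance) (normalizes_of_normal _ hNn) (k := a)
    (by rw [Subgroup.card_bot]; exact Nat.one_le_pow _ _ hp.pos) hlt.le
  have hNU : ¬ N ≤ U := fun h => by
    have := Subgroup.card_le_of_le h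
    omega
  have hUP : U < P := lt_of_le_of_ne (hUN.trans hNP) fun h => hNU (h ▸ hNP)
  obtain ⟨T, hT, hTg⟩ := hgood U hUP hUc
  have hTN : (T ⊓ N).Normal := hT.normal hUP.le
    (Normalizes.of_commute fun s hs x hx => hcomm s hs x hx.2)
    ((Normalizes.self T).inf (normalizes_of_normal T hNn))
  -- If T meets N trivially, N ≤ UT forces N ≤ U. If N ≤ T, the S-invariant U = U ∩ N would have to
  -- be trivial or N, or else |N| = p.
  rcases hN.2.2.2 _ hTN bot_le inf_le_right with h | h
  · exact hNU (hT.le_of_le hUN (h ▸ bot_le))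
  · rcases card_eq_or_inf_eq_bot_or_le hp S hN (hP.to_le hNP) hcomm hUP.le hT (inf_eq_right.1 h) hTg
      (by rwa [inf_eq_left.2 hUN]) with h1 | h1 | h1
    · rw [h1] at hlt
      exact absurd (Nat.pow_le_pow_right hp.pos ha) (by rw [pow_one]; omega)
    · rw [inf_eq_left.2 hUN] at h1
      rw [h1, Subgroup.card_bot] at hUc
      exact absurd hUc.symm (Nat.one_lt_pow (by omega) hp.one_lt).ne'
    · exact hNU h1

/-- A complement-like hyperplane of an elementary abelian `p`-group: a subgroup of index `p`
containing `N₁` and avoiding `y`. -/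
theorem exists_hyperplane (hp : p.Prime) {P N₁ : Subgroup G}
    (hexp : ∀ x ∈ P, x ^ p = 1) (hab : ∀ x ∈ P, ∀ y ∈ P, x * y = y * x) (hN₁ : N₁ ≤ P) {y : G}
    (hy : y ∈ P) (hyN : y ∉ N₁) :
    ∃ C : Subgroup G, N₁ ≤ C ∧ C ≤ P ∧ y ∉ C ∧ C.relIndex P = p := by
  obtain ⟨C, hNC, ⟨hCP, hyC⟩, hmax⟩ :=
    (Set.toFinite {C : Subgroup G | C ≤ P ∧ y ∉ C}).exists_le_maximal (a := N₁) ⟨hN₁, hyN⟩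
  refine ⟨C, hNC, hCP, hyC, ?_⟩
  have hnorm : ∀ w ∈ P, Normalizes (Subgroup.zpowers w) C := fun w hw =>
    Normalizes.of_commute fun s hs x hx => hab s ((Subgroup.zpowers_le).2 hw hs) x (hCP hx)
  have hidx : ∀ w ∈ P, w ∉ C → C.relIndex (Subgroup.zpowers w ⊔ C) = p := fun w hw hwC =>
    relIndex_zpowers_of_pow_mem hp hwC (hexp w hw ▸ C.one_mem) (hnorm w hw)
  have hP : Subgroup.zpowers y ⊔ C = P := by
    refine le_antisymm (sup_le ((Subgroup.zpowers_le).2 hy) hCP) fun w hw => ?_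
    by_cases hwC : w ∈ C
    · exact Subgroup.mem_sup_right hwC
    · have hyw : y ∈ Subgroup.zpowers w ⊔ C := by
        by_contra hyw
        have := hmax (y := Subgroup.zpowers w ⊔ C)
          ⟨sup_le ((Subgroup.zpowers_le).2 hw) hCP, hyw⟩ le_sup_right
        exact hwC (this (Subgroup.mem_sup_left (Subgroup.mem_zpowers w)))
      rcases eq_or_eq_of_relIndex_prime hp (hidx w hw hwC) (le_sup_right : C ≤ Subgroup.zpowers y ⊔ C)
        (sup_le ((Subgroup.zpowers_le).2 hyw) le_sup_right) with h | h
      · exact absurd (h ▸ Subgroup.mem_sup_left (Subgroup.mem_zpowers y)) hyC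
      · rw [h]
        exact Subgroup.mem_sup_left (Subgroup.mem_zpowers w)
  rw [← hP]
  exact hidx y hy hyC

/-- The case of an elementary abelian `P` with a unique minimal normal subgroup of order greater
than `p`. -/
theorem false_of_elementary (hp : p.Prime) {a : ℕ} {P N : Subgroup G} (hPn : P.Normal)
    (hP : IsPGroup p P) (hlt : p ^ a < Nat.card P)
    (hgood : ∀ X : Subgroup G, X < P → Nat.card X = p ^ a → HasGoodSupplement p X)
    (hN : IsChiefFactor ⊥ N) (hNP : N ≤ P) (hNa : Nat.card N ≤ p ^ a) (hNc : Nat.card N ≠ p)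
    (huniq : ∀ M : Subgroup G, IsChiefFactor ⊥ M → M ≤ P → M = N)
    (hexp : ∀ x ∈ P, x ^ p = 1) (hab : ∀ x ∈ P, ∀ y ∈ P, x * y = y * x) : False := by
  have : Fact p.Prime := ⟨hp⟩
  let S : Sylow p G := default
  have hPS : P ≤ S := hP.le_sylow_of_normal S
  have hNn := hN.2.1
  obtain ⟨N₁, -, hN₁N, hN₁S, hN₁i⟩ := exists_normalizes_relIndex hp S.isPGroup' (hNP.trans hPS)
    hN.2.2.1 (normalizes_of_normal _ inferInstance) (normalizes_of_normal _ hNn)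
  have hN₁lt : N₁ < N := lt_of_le_of_ne hN₁N (by
    rintro rfl
    rw [Subgroup.relIndex_self] at hN₁i
    exact hp.one_lt.ne hN₁i)
  obtain ⟨y, hyN, hyN₁⟩ := SetLike.exists_of_lt hN₁lt
  obtain ⟨C, hNC, hCP, hyC, hCi⟩ := exists_hyperplane hp hexp hab (hN₁N.trans hNP) (hNP hyN) hyN₁
  have hnorm : ∀ X ≤ P, Normalizes P X := fun X hX =>
    Normalizes.of_commute fun s hs x hx => hab s hs x (hX hx)
  have hCc : p ^ a ≤ Nat.card C := by
    obtain ⟨m, hm⟩ := IsPGroup.iff_card.1 hP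
    obtain ⟨j, hj⟩ := IsPGroup.iff_card.1 (hP.to_le hCP)
    have h1 := card_mul_relIndex hCP
    rw [hCi, hj, ← pow_succ] at h1
    rw [← h1, Nat.pow_lt_pow_iff_right hp.one_lt] at hlt
    rw [hj]
    exact Nat.pow_le_pow_right hp.pos (by omega)
  -- Only X ∩ N = N₁ has to be S-invariant, not X. Confining X to the hyperplane C, which misses y,
  -- gives that intersection.
  obtain ⟨X, hNX, hXC, -, hXc⟩ := exists_normalizes_card_eq hp hP hCP hNC
    (hnorm N₁ (hN₁N.trans hNP)) (hnorm C hCP) ((Subgroup.card_le_of_le hN₁N).trans hNa) hCc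
  have hXP : X < P := lt_of_le_of_ne (hXC.trans hCP) (by
    rintro rfl
    omega)
  have hXN : X ⊓ N = N₁ := by
    refine (eq_or_eq_of_relIndex_prime hp hN₁i (le_inf hNX hN₁N) inf_le_right).resolve_right
      fun h => hyC (hXC (?_ : y ∈ X))
    rw [← h] at hyN
    exact hyN.1
  obtain ⟨T, hT, hTg⟩ := hgood X hXP hXc
  have hTP : (T ⊓ P).Normal := hT.normal hXP.le (hnorm _ inf_le_right)
    ((Normalizes.self T).inf (normalizes_of_normal T hPn))
  have hTPb : T ⊓ P ≠ ⊥ := fun h => hXP.not_ge (hT.le_of_le hXP.le (h ▸ bot_le))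
  obtain ⟨M, hMT, hM⟩ := exists_minimal_normal hTP hTPb
  have hMN := huniq M hM (hMT.trans inf_le_right)
  subst hMN
  exact not_le_of_relIndex_prime hp S hM (hP.to_le hNP) (fun x hx n hn => hab x hx n (hNP hn))
    hXP.le hT hTg hXN hN₁S hN₁i hNc (hMT.trans inf_le_left)

/-- The case in which all minimal normal subgroups of `G` in `P` have order `p ^ a` with `a ≥ 2`. -/
theorem false_of_card_minimal_normal_eq (hp : p.Prime) {a : ℕ} (ha : 2 ≤ a) {P : Subgroup G}
    (hPn : P.Normal) (hP : IsPGroup p P) (hlt : p ^ a < Nat.card P)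
    (hgood : ∀ X : Subgroup G, X < P → Nat.card X = p ^ a → HasGoodSupplement p X)
    (hgood' : ∀ X : Subgroup G, X < P → Nat.card X = p ^ (a + 1) → HasGoodSupplement p X)
    (hmin : ∀ M : Subgroup G, IsChiefFactor ⊥ M → M ≤ P → Nat.card M = p ^ a) : False := by
  have : Fact p.Prime := ⟨hp⟩
  have hcomm : ∀ M : Subgroup G, IsChiefFactor ⊥ M → M ≤ P → ∀ x ∈ P, ∀ n ∈ M, x * n = n * x :=
    fun M hM hMP => commute_of_minimal_normal hp hPn hP hM hMP
  have hpa : p ^ a ≠ p := fun h => by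
    have := Nat.pow_right_injective hp.two_le (h.trans (pow_one p).symm)
    omega
  let S : Sylow p G := default
  have hPS : P ≤ S := hP.le_sylow_of_normal S
  have hPb : P ≠ ⊥ := by
    rintro rfl
    rw [Subgroup.card_bot] at hlt
    exact absurd hlt (Nat.one_le_pow _ _ hp.pos).not_gt
  obtain ⟨N, hNP, hN⟩ := exists_minimal_normal hPn hPb
  have hNn := hN.2.1
  have hNc := hmin N hN hNP
  have hNp := hP.to_le hNP
  have hNcomm := hcomm N hN hNP
  have hNlt : N < P := lt_of_le_of_ne hNP (by rintro rfl; omega)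
  have hNexp : ∀ n ∈ N, n ^ p = 1 := by
    have h1 := sup_powComm_lt hp hNp hN.2.2.1
    rw [bot_sup_eq] at h1
    have h2 := (hN.2.2.2 _ (powComm_normal p hNn) bot_le h1.le).resolve_right h1.ne
    intro n hn
    have := pow_mem_powComm (p := p) hn
    rwa [h2, Subgroup.mem_bot] at this
  -- a Sylow-invariant `L` above `N` and an element `x` of `L` outside `N`
  obtain ⟨L, hNL, hLP, hLS, hLc⟩ := exists_normalizes_card_mul hp S.isPGroup' hPS hNlt
    (normalizes_of_normal _ hNn) (normalizes_of_normal _ hPn)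
  have hLi : N.relIndex L = p := by
    have h1 := card_mul_relIndex hNL
    rw [hLc, mul_comm] at h1
    exact Nat.eq_of_mul_eq_mul_right Nat.card_pos h1
  have hNLlt : N < L := lt_of_le_of_ne hNL (by
    rintro rfl
    rw [Subgroup.relIndex_self] at hLi
    exact hp.one_lt.ne hLi)
  obtain ⟨x, hxL, hxN⟩ := SetLike.exists_of_lt hNLlt
  have hxP := hLP hxL
  have hxp : x ^ p ∈ N := (pow_mem_of_relIndex_prime hp hLi (normalizes_of_normal _ hNn)).1 x hxL
  have hLx : N ⊔ Subgroup.zpowers x = L := by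
    refine (eq_or_eq_of_relIndex_prime hp hLi le_sup_left
      (sup_le hNL ((Subgroup.zpowers_le).2 hxL))).resolve_left fun h => hxN ?_
    rw [← h]
    exact Subgroup.mem_sup_right (Subgroup.mem_zpowers x)
  have hcS : Normalizes (S : Subgroup G) (Subgroup.zpowers (x ^ p)) := by
    -- Conjugation by s sends x to n x ^ k with n in N; as N is central in P of exponent p, the p-th
    -- power of this is a power of x ^ p.
    refine normalizes_iff_map_le.2 fun s hs => ?_
    rw [MonoidHom.map_zpowers]
    refine (Subgroup.zpowers_le).2 ?_
    have h1 := hLS s hs x hxL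
    rw [← hLx, mem_sup_iff_of_normalizes (normalizes_of_normal _ hNn)] at h1
    obtain ⟨n, hn, w, hw, hnw⟩ := h1
    obtain ⟨k, rfl⟩ := Subgroup.mem_zpowers_iff.1 hw
    have h2 : s * x ^ p * s⁻¹ = (x ^ p) ^ k := by
      have h3 : Commute n (x ^ k) := (hNcomm _ (P.zpow_mem hxP k) n hn).symm
      rw [← conj_pow, ← hnw, h3.mul_pow, hNexp n hn, one_mul, ← zpow_natCast, ← zpow_mul,
        mul_comm, zpow_mul, zpow_natCast]
    change s * x ^ p * s⁻¹ ∈ _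
    rw [h2]
    exact Subgroup.zpow_mem _ (Subgroup.mem_zpowers _) k
  have hclt : Subgroup.zpowers (x ^ p) < N := by
    refine lt_of_le_of_ne ((Subgroup.zpowers_le).2 hxp) fun h => ?_
    have h1 : Nat.card (Subgroup.zpowers (x ^ p)) ∣ p := by
      rw [Nat.card_zpowers]
      exact orderOf_dvd_of_pow_eq_one (hNexp _ hxp)
    rw [h, hNc] at h1
    rcases (Nat.dvd_prime hp).1 h1 with h2 | h2
    · exact (Nat.one_lt_pow (by omega) hp.one_lt).ne' h2
    · exact hpa h2
  -- The hyperplane is made to contain x ^ p so that adjoining x to it multiplies the order by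
  -- exactly p.
  obtain ⟨N₁, hcN₁, hN₁N, hN₁S, hN₁i⟩ := exists_normalizes_relIndex hp S.isPGroup'
    (hNP.trans hPS) hclt hcS (normalizes_of_normal _ hNn)
  have hN₁c : Nat.card N₁ * p = p ^ a := by rw [← hNc, ← card_mul_relIndex hN₁N, hN₁i]
  have hN₁comm : ∀ w ∈ P, ∀ n ∈ N₁, w * n = n * w := fun w hw n hn => hNcomm w hw n (hN₁N hn)
  -- the first subgroup, of order `p ^ a`
  have hXi : N₁.relIndex (Subgroup.zpowers x ⊔ N₁) = p :=
    relIndex_zpowers_of_pow_mem hp (fun h => hxN (hN₁N h)) (hcN₁ (Subgroup.mem_zpowers _))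
      (Normalizes.of_commute fun s hs n hn => hN₁comm s ((Subgroup.zpowers_le).2 hxP hs) n hn)
  set X := Subgroup.zpowers x ⊔ N₁ with hX
  have hXc : Nat.card X = p ^ a := by
    rw [← card_mul_relIndex (le_sup_right : N₁ ≤ X), hXi, hN₁c]
  have hXN : X ⊓ N = N₁ := by
    refine (eq_or_eq_of_relIndex_prime hp hXi (le_inf le_sup_right hN₁N) inf_le_left).resolve_right
      fun h => hxN ?_
    exact inf_eq_left.1 h (Subgroup.mem_sup_left (Subgroup.mem_zpowers x))
  have hXP : X < P := lt_of_le_of_ne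
    (sup_le ((Subgroup.zpowers_le).2 hxP) (hN₁N.trans hNP)) fun h => by
      rw [h] at hXc
      omega
  obtain ⟨T, hT, hTg⟩ := hgood X hXP hXc
  have hTNn : (T ⊓ N).Normal := hT.normal hXP.le
    (Normalizes.of_commute fun s hs n hn => hNcomm s hs n hn.2)
    ((Normalizes.self T).inf (normalizes_of_normal T hNn))
  have hTN : T ⊓ N = ⊥ := (hN.2.2.2 _ hTNn bot_le inf_le_right).resolve_right fun h =>
    not_le_of_relIndex_prime hp S hN hNp hNcomm hXP.le hT hTg hXN hN₁S hN₁i (hNc ▸ hpa)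
      (inf_eq_right.1 h)
  -- the normal complement `Q` of `N` in `P`
  set Q := T ⊓ P with hQ
  have hNQ : N ⊓ Q = ⊥ := by
    rw [eq_bot_iff, ← hTN]
    exact le_inf (inf_le_right.trans inf_le_left) inf_le_left
  have hPc : Nat.card P ≤ p ^ a * Nat.card Q := hXc ▸ card_le_mul_of_forall_exists fun w hw =>
    hT.exists_mul hXP.le hw
  have hNQP : N ⊔ Q = P := by
    refine eq_of_le_of_card_eq (sup_le hNP inf_le_right)
      (le_antisymm (Subgroup.card_le_of_le (sup_le hNP inf_le_right)) ?_)
    rw [card_sup_of_disjoint (normalizes_of_normal _ hNn) hNQ, hNc]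
    exact hPc
  have hQn : Q.Normal := by
    refine hT.normal hXP.le ?_ ((Normalizes.self T).inf (normalizes_of_normal T hPn))
    rw [normalizes_iff, ← hNQP]
    refine sup_le (normalizes_iff.1 ?_) (normalizes_iff.1 (Normalizes.self Q))
    exact Normalizes.of_commute fun n hn s hs => (hNcomm s hs.2 n hn).symm
  have hQb : Q ≠ ⊥ := by
    intro h
    rw [h, Subgroup.card_bot, mul_one] at hPc
    omega
  obtain ⟨M, hMQ, hM⟩ := exists_minimal_normal hQn hQb
  have hMn := hM.2.1
  have hMP : M ≤ P := hMQ.trans inf_le_right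
  have hMc := hmin M hM hMP
  have hNM : N ⊓ M = ⊥ := eq_bot_iff.2 (hNQ ▸ inf_le_inf_left N hMQ)
  have hWc : Nat.card (N ⊔ M : Subgroup G) = p ^ a * p ^ a := by
    rw [card_sup_of_disjoint (normalizes_of_normal _ hNn) hNM, hNc, hMc]
  set W := N ⊔ M with hW
  have hWP : W ≤ P := sup_le hNP hMP
  have hWcomm : ∀ w ∈ P, ∀ z ∈ W, w * z = z * w := by
    intro w hw z hz
    obtain ⟨n, hn, m, hm, rfl⟩ := (mem_sup_iff_of_normalizes (normalizes_of_normal M hNn)).1 hz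
    have h1 : Commute w n := hNcomm w hw n hn
    have h2 : Commute w m := hcomm M hM hMP w hw m hm
    exact (h1.mul_right h2).eq
  have hWcomm' : ∀ (A B : Subgroup G), A ≤ W → B ≤ P → Normalizes B A := fun A B hA hB =>
    Normalizes.of_commute fun s hs z hz => hWcomm s (hB hs) z (hA hz)
  -- the second subgroup, of order `p ^ (a + 1)`
  obtain ⟨Y, -, hYM, hYS, hYc⟩ := exists_normalizes_card_eq hp S.isPGroup' (hMP.trans hPS) bot_le
    (normalizes_of_normal _ inferInstance) (normalizes_of_normal _ hMn) (k := 2)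
    (by rw [Subgroup.card_bot]; exact Nat.one_le_pow _ _ hp.pos)
    (hMc ▸ Nat.pow_le_pow_right hp.pos ha)
  have hN₁W : N₁ ≤ W := hN₁N.trans le_sup_left
  have hYW : Y ≤ W := hYM.trans le_sup_right
  have hX'c : Nat.card (N₁ ⊔ Y : Subgroup G) = p ^ (a + 1) := by
    rw [card_sup_of_disjoint (hWcomm' _ _ hN₁W (hYW.trans hWP))
      (eq_bot_iff.2 (hNM ▸ inf_le_inf hN₁N hYM)), hYc, pow_succ p a, ← hN₁c]
    ring
  have hX'S : Normalizes (S : Subgroup G) (N₁ ⊔ Y) := hN₁S.sup hYS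
  have hX'W : N₁ ⊔ Y ≤ W := sup_le hN₁W hYW
  have hX'N : (N₁ ⊔ Y) ⊓ N = N₁ := by
    refine le_antisymm ?_ (le_inf le_sup_left hN₁N)
    rintro z ⟨hz, hzN⟩
    obtain ⟨n, hn, y, hy, rfl⟩ :=
      (mem_sup_iff_of_normalizes (hWcomm' _ _ hN₁W (hYW.trans hWP))).1 hz
    have h1 : y ∈ N := by simpa using N.mul_mem (N.inv_mem (hN₁N hn)) hzN
    have h2 : y ∈ N ⊓ M := ⟨h1, hYM hy⟩
    rw [hNM, Subgroup.mem_bot] at h2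
    rwa [h2, mul_one]
  set X' := N₁ ⊔ Y with hX'
  have hcardlt : p ^ (a + 1) < p ^ a * p ^ a := by
    rw [← pow_add]
    exact Nat.pow_lt_pow_right hp.one_lt (by omega)
  have hWX' : ¬ W ≤ X' := fun h => by
    have := Subgroup.card_le_of_le h
    omega
  have hX'P : X' < P := lt_of_le_of_ne (hX'W.trans hWP) fun h => hWX' (h ▸ hWP)
  obtain ⟨T', hT', hTg'⟩ := hgood' X' hX'P hX'c
  have hT'Nn : (T' ⊓ N).Normal := hT'.normal hX'P.le
    (Normalizes.of_commute fun s hs n hn => hNcomm s hs n hn.2)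
    ((Normalizes.self T').inf (normalizes_of_normal T' hNn))
  have hT'N : T' ⊓ N = ⊥ := (hN.2.2.2 _ hT'Nn bot_le inf_le_right).resolve_right fun h =>
    not_le_of_relIndex_prime hp S hN hNp hNcomm hX'P.le hT' hTg' hX'N hN₁S hN₁i (hNc ▸ hpa)
      (inf_eq_right.1 h)
  set K := T' ⊓ W with hK
  have hKn : K.Normal := hT'.normal hX'P.le (hWcomm' _ _ inf_le_right le_rfl)
    ((Normalizes.self T').inf (normalizes_of_normal T' inferInstance))
  have hKb : K ≠ ⊥ := fun h => hWX' (hT'.le_of_le hX'W (hK ▸ h.le.trans bot_le))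
  obtain ⟨M', hM'K, hM'⟩ := exists_minimal_normal hKn hKb
  have hM'P : M' ≤ P := hM'K.trans (inf_le_right.trans hWP)
  have hM'c := hmin M' hM' hM'P
  have hKM' : M' = K := by
    -- K meets N trivially inside W of order p ^ (2a), so |K| ≤ p ^ a; but it contains a minimal
    -- normal subgroup of that order.
    refine eq_of_le_of_card_eq hM'K (le_antisymm (Subgroup.card_le_of_le hM'K) ?_)
    have h1 : N ⊓ K = ⊥ := by
      rw [eq_bot_iff, ← hT'N]
      exact le_inf (inf_le_right.trans inf_le_left) inf_le_left
    have h2 := Subgroup.card_le_of_le (sup_le le_sup_left inf_le_right : N ⊔ K ≤ W)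
    rw [card_sup_of_disjoint (normalizes_of_normal _ hNn) h1, hNc, hWc] at h2
    rw [hM'c]
    exact Nat.le_of_mul_le_mul_left h2 (pow_pos hp.pos a)
  rw [hKM'] at hM' hM'P hM'c
  rcases card_eq_or_inf_eq_bot_or_le hp S hM' (hP.to_le hM'P) (hcomm K hM' hM'P) hX'P.le hT'
    inf_le_left hTg' (hX'S.inf (normalizes_of_normal _ hKn)) with h | h | h
  · exact hpa (hM'c.symm.trans h)
  · have h1 := Subgroup.card_le_of_le (sup_le hX'W inf_le_right : X' ⊔ K ≤ W)
    rw [card_sup_of_disjoint (hWcomm' _ _ hX'W hM'P) h, hX'c, hM'c, hWc] at h1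
    have h2 := Nat.le_of_mul_le_mul_right h1 (pow_pos hp.pos a)
    rw [Nat.pow_le_pow_iff_right hp.one_lt] at h2
    omega
  · exact hWX' (hT'.le_of_le hX'W h)

/-- If the subgroups of `P` of orders `p ^ a` and `p ^ (a + 1)` have good supplements, `1 ≤ a` and
`p ^ a < |P|`, then the residual `p'`-elements centralise `P`. -/
theorem centralMod_of_subgroups (hp : p.Prime) {a : ℕ} (ha : 1 ≤ a) {G : Type u} [Group G]
    [Finite G] {P : Subgroup G} (hPn : P.Normal) (hP : IsPGroup p P) (hlt : p ^ a < Nat.card P)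
    (hgood : ∀ X : Subgroup G, X < P → Nat.card X = p ^ a → HasGoodSupplement p X)
    (hgood' : ∀ X : Subgroup G, X < P → Nat.card X = p ^ (a + 1) → HasGoodSupplement p X) :
    CentralMod p ⊥ P := by
  have : Fact p.Prime := ⟨hp⟩
  induction a using Nat.strong_induction_on generalizing G with
  | _ a ih =>
    rcases Nat.eq_or_lt_of_le ha with rfl | ha2
    · have hz : ∀ x ∈ P, ∀ k, orderOf x = p ^ k → p ^ k < Nat.card P →
          Subgroup.zpowers x < P ∧ Nat.card (Subgroup.zpowers x) = p ^ k := by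
        intro x hx k hk hkP
        have h1 : Nat.card (Subgroup.zpowers x) = p ^ k := by rw [Nat.card_zpowers, hk]
        refine ⟨lt_of_le_of_ne ((Subgroup.zpowers_le).2 hx) fun h => ?_, h1⟩
        rw [h] at h1
        omega
      refine centralMod_of_minimal_subgroups hp hP (fun x hx hxp => ?_) (fun hp2 => ?_) P hPn le_rfl
      · obtain ⟨h1, h2⟩ := hz x hx 1 (by rw [hxp, pow_one]) hlt
        exact hgood _ h1 h2
      · subst hp2
        -- For a = 1 and p = 2 the order 4 is p ^ (a + 1). The hypothesis covers proper subgroups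
        -- only, and for |P| ≤ 4 the group is quaternion-free anyway.
        by_cases h4 : Nat.card P ≤ 4
        · exact Or.inl (isQuaternionFree_of_card_lt (by omega))
        · refine Or.inr fun x hx hx4 => ?_
          obtain ⟨h1, h2⟩ := hz x hx 2 (by rw [hx4]; norm_num) (by omega)
          exact hgood' _ h1 h2
    · by_contra hnot
      have hquot : ∀ N : Subgroup G, IsChiefFactor ⊥ N → N ≤ P → Nat.card N < p ^ a →
          CentralMod p N P := by
        intro N hN hNP hNa
        have hNn := hN.2.1
        obtain ⟨j, hj⟩ := IsPGroup.iff_card.1 (hP.to_le hNP)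
        have hj1 : j ≠ 0 := by
          rintro rfl
          rw [pow_zero, Subgroup.card_eq_one] at hj
          exact hN.2.2.1.ne' hj
        rw [hj, Nat.pow_lt_pow_iff_right hp.one_lt] at hNa
        have hsurj := QuotientGroup.mk'_surjective N
        have hPcomap : (P.map (QuotientGroup.mk' N)).comap (QuotientGroup.mk' N) = P :=
          Subgroup.comap_map_eq_self (by rwa [QuotientGroup.ker_mk'])
        -- Subgroups of order p ^ (k - j) of G/N pull back to subgroups of order p ^ k containing N,
        -- so the induction hypothesis applies with a - j, which is at least 1.
        have hlift : ∀ k, (∀ X : Subgroup G, X < P → Nat.card X = p ^ k → HasGoodSupplement p X) →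
            j ≤ k → ∀ X : Subgroup (G ⧸ N), X < P.map (QuotientGroup.mk' N) →
              Nat.card X = p ^ (k - j) → HasGoodSupplement p X := by
          intro k hk hjk X hX hXc
          rw [← Subgroup.map_comap_eq_self_of_surjective hsurj X]
          refine (hk _ ?_ ?_).map hsurj (Subgroup.ker_le_comap _ X)
          · rw [← hPcomap]
            exact (Subgroup.comap_lt_comap_of_surjective hsurj).2 hX
          · rw [card_comap_mk', hj, hXc, ← pow_add]
            congr 1
            omega
        refine CentralMod.of_quotient (ih (a - j) (by omega) (by omega) (hPn.map _ hsurj)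
          (hP.map _) ?_ (hlift a hgood (by omega)) ?_)
        · have h1 := card_comap_mk' N (P.map (QuotientGroup.mk' N))
          rw [hPcomap, hj] at h1
          rw [h1] at hlt
          have h2 : p ^ a = p ^ j * p ^ (a - j) := by rw [← pow_add]; congr 1; omega
          rw [h2] at hlt
          exact Nat.lt_of_mul_lt_mul_left hlt
        · have h3 : a - j + 1 = a + 1 - j := by omega
          rw [h3]
          exact hlift (a + 1) hgood' (by omega)
      have hcardp : ∀ N : Subgroup G, IsChiefFactor ⊥ N → N ≤ P → Nat.card N = p → False := by
        intro N hN hNP hNc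
        have hNn := hN.2.1
        have h1 : CentralMod p ⊥ N :=
          centralMod_of_relIndex_eq hp (by rwa [Subgroup.relIndex_bot_left])
        refine hnot (h1.trans hp hP hNP (hquot N hN hNP ?_))
        rw [hNc]
        exact lt_self_pow₀ hp.one_lt ha2
      have hsmall : ∀ N : Subgroup G, IsChiefFactor ⊥ N → N ≤ P → ¬ Nat.card N < p ^ a := by
        intro N hN hNP hNa
        have hNn := hN.2.1
        have hCN := hquot N hN hNP hNa
        -- A second minimal normal subgroup M would meet N trivially and so embed in the centralised
        -- quotient P/N; it would then have order p, which `hcardp` excludes.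
        have huniq : ∀ M : Subgroup G, IsChiefFactor ⊥ M → M ≤ P → M = N := by
          intro M hM hMP
          by_contra hne
          have hMn := hM.2.1
          have hMN : M ⊓ N = ⊥ := by
            refine (hM.2.2.2 _ inferInstance bot_le inf_le_left).resolve_right fun h => ?_
            rcases hN.2.2.2 M hMn bot_le (inf_eq_left.1 h) with h1 | h1
            · exact hM.2.2.1.ne' h1
            · exact hne h1
          have hMc : CentralMod p ⊥ M := fun g hg hg' x hx => by
            rw [← hMN]
            exact ⟨M.mul_mem (M.inv_mem hx) (hMn.conj_mem x hx g), hCN g hg hg' x (hMP hx)⟩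
          have h1 := hM.relIndex_eq hp (hP.to_le hMP) hMc
          rw [Subgroup.relIndex_bot_left] at h1
          exact hcardp M hM hMP h1
        have hΦ : powComm p P = ⊥ := by
          by_contra hb
          obtain ⟨M, hMΦ, hM⟩ := exists_minimal_normal (powComm_normal p hPn) hb
          have hMN := huniq M hM (hMΦ.trans (powComm_le p P))
          subst hMN
          -- A nontrivial Frattini subgroup contains N, so centrality of P/N is centrality modulo
          -- the Frattini subgroup.
          exact hnot ((hCN.mono_left hMΦ).of_powComm hp hPn hP)
        refine false_of_elementary hp hPn hP hlt hgood hN hNP hNa.le (hcardp N hN hNP) huniq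
          (fun x hx => ?_) (fun x hx y hy => ?_)
        · have := pow_mem_powComm (p := p) hx
          rwa [hΦ, Subgroup.mem_bot] at this
        · have := comm_mem_powComm (p := p) hx hy
          rwa [hΦ, Subgroup.mem_bot, mul_inv_eq_one, mul_inv_eq_iff_eq_mul] at this
      exact false_of_card_minimal_normal_eq hp ha2 hPn hP hlt hgood hgood' fun M hM hMP =>
        le_antisymm (card_minimal_normal_le hp ha hPn hP hgood hM hMP)
          (not_lt.1 (hsmall M hM hMP))

end PiSupp

/-! ### The supersoluble hypercentre and the main theorem -/

namespace PiSupp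

universe u

/-- The semidirect product attached to a chief factor of prime order is supersoluble. -/
theorem isSupersoluble_factorSemidirect {G : Type u} [Group G] {p : ℕ} (hp : p.Prime)
    (K L : Subgroup G) [K.Normal] [L.Normal] (h : K.relIndex L = p) :
    IsSupersoluble (FactorSemidirect K L) := by
  have : Fact p.Prime := ⟨hp⟩
  have hcard : Nat.card (factor K L) = p := (card_factor K L).trans h
  have hcyc : IsCyclic (factor K L) := isCyclic_of_prime_card hcard
  have hunits : ∀ n : ℕ, n = p → IsCyclic (ZMod n)ˣ := by
    rintro n rfl
    infer_instance
  -- The quotient embeds in the automorphism group of a group of order p, which is cyclic of order p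
  -- - 1.
  have hQ : IsCyclic (G ⧸ (conjFactor K L).ker) := by
    have := hunits _ hcard
    exact isCyclic_of_injective
      ((IsCyclic.mulAutMulEquiv (factor K L)).toMonoidHom.comp
        (QuotientGroup.kerLift (conjFactor K L)))
      ((IsCyclic.mulAutMulEquiv (factor K L)).injective.comp
        (QuotientGroup.kerLift_injective (conjFactor K L)))
  let V : Subgroup (FactorSemidirect K L) := SemidirectProduct.inl.range
  have hV : V.Normal := by
    change (SemidirectProduct.inl (φ := QuotientGroup.kerLift (conjFactor K L))).range.Normal
    rw [SemidirectProduct.range_inl_eq_ker_rightHom]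
    infer_instance
  let N : ℕ → Subgroup (FactorSemidirect K L)
    | 0 => ⊥
    | 1 => V
    | _ => ⊤
  have hN : ∀ i, (N i).Normal := by
    intro i
    match i with
    | 0 => exact (inferInstance : (⊥ : Subgroup (FactorSemidirect K L)).Normal)
    | 1 => exact hV
    | _ + 2 => exact (inferInstance : (⊤ : Subgroup (FactorSemidirect K L)).Normal)
  refine ⟨2, N, hN, rfl, rfl, fun i hi => ?_⟩
  match i with
  | 0 =>
    refine ⟨bot_le, isCyclic_of_prime_card (p := p) ?_⟩
    rw [card_factor]
    change (⊥ : Subgroup (FactorSemidirect K L)).relIndex V = p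
    rw [Subgroup.relIndex_bot_left, ← hcard]
    exact (Nat.card_congr
      (MonoidHom.ofInjective (SemidirectProduct.inl_injective
        (φ := QuotientGroup.kerLift (conjFactor K L)))).toEquiv).symm
  | 1 =>
    refine ⟨le_top, ?_⟩
    have hs : Function.Surjective ((QuotientGroup.mk' V).comp
        (SemidirectProduct.inr (φ := QuotientGroup.kerLift (conjFactor K L)))) := by
      intro x
      obtain ⟨x, rfl⟩ := QuotientGroup.mk_surjective x
      refine ⟨x.right, ?_⟩
      rw [MonoidHom.comp_apply, QuotientGroup.mk'_apply, QuotientGroup.eq]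
      refine hV.mem_comm ⟨x.left, ?_⟩
      rw [eq_mul_inv_iff_mul_eq]
      exact SemidirectProduct.inl_left_mul_inr_right x
    have hc : IsCyclic (FactorSemidirect K L ⧸ V) := isCyclic_of_surjective _ hs
    exact (inferInstance : IsCyclic (factor V (⊤ : Subgroup (FactorSemidirect K L))))

theorem le_supersolubleHypercentre {G : Type u} [Group G] [Finite G] {p : ℕ} (hp : p.Prime)
    {P : Subgroup G} (hPn : P.Normal) (hP : IsPGroup p P) (h : CentralMod p ⊥ P) :
    P ≤ supersolubleHypercentre G := by
  refine le_sSup ⟨hPn, fun K L _ _ hKL hLP => ?_⟩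
  exact isSupersoluble_factorSemidirect hp K L
    (hKL.relIndex_eq hp (hP.to_le hLP) ((h.mono_left bot_le).mono_right hLP))

end PiSupp

theorem theoremB {G : Type*} [Group G] [Finite G] {p : ℕ} (hp : p.Prime)
    (P : Subgroup G) (hPnormal : P.Normal) (hP : IsPGroup p P)
    (D : Subgroup G) (hDP : D ≤ P) (hDcard : Nat.card D < Nat.card P)
    (hsub : ∀ n : ℕ, n = 0 ∨ n = 1 → ∀ H : Subgroup G, H < P →
      Nat.card H = p ^ n * Nat.card D →
        PiSupp.IsPiSupplemented H ∨ PiSupp.HasPSupersolubleSupplement p H)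
    (hfour : ¬ PiSupp.IsQuaternionFree P → Nat.card D = 1 → ∀ H : Subgroup G, H ≤ P →
      IsCyclic H → Nat.card H = 4 →
        PiSupp.IsPiSupplemented H ∨ PiSupp.HasPSupersolubleSupplement 2 H) :
    P ≤ PiSupp.supersolubleHypercentre G := by
  have : Fact p.Prime := ⟨hp⟩
  refine PiSupp.le_supersolubleHypercentre hp hPnormal hP ?_
  obtain ⟨a, ha⟩ := IsPGroup.iff_card.1 (hP.to_le hDP)
  have hgood : ∀ n : ℕ, n = 0 ∨ n = 1 → ∀ X : Subgroup G, X < P → Nat.card X = p ^ (a + n) →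
      PiSupp.HasGoodSupplement p X := fun n hn X hX hXc =>
    PiSupp.hasGoodSupplement_of hp (hP.to_le hX.le)
      (hsub n hn X hX (by rw [hXc, ha, pow_add, mul_comm]))
  rcases Nat.eq_zero_or_pos a with rfl | ha1
  -- If |P| = p there are no proper subgroups of order p to apply `hsub` to, but P is then central
  -- outright.
  · by_cases hPp : Nat.card P = p
    · exact PiSupp.centralMod_of_relIndex_eq hp (by rwa [Subgroup.relIndex_bot_left])
    · refine PiSupp.centralMod_of_minimal_subgroups hp hP (fun x hx hxp => ?_) (fun hp2 => ?_) P
        hPnormal le_rfl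
      · refine hgood 1 (Or.inr rfl) _ (lt_of_le_of_ne ((Subgroup.zpowers_le).2 hx) fun h => hPp ?_) ?_
        · rw [← h, Nat.card_zpowers, hxp]
        · rw [Nat.card_zpowers, hxp, zero_add, pow_one]
      · subst hp2
        by_cases hQ : PiSupp.IsQuaternionFree P
        · exact Or.inl hQ
        · refine Or.inr fun x hx hx4 => ?_
          have hxP : Subgroup.zpowers x ≤ P := (Subgroup.zpowers_le).2 hx
          exact PiSupp.hasGoodSupplement_of hp (hP.to_le hxP)
            (hfour hQ ha _ hxP inferInstance (by rw [Nat.card_zpowers, hx4]))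
  · exact PiSupp.centralMod_of_subgroups hp ha1 hPnormal hP (ha ▸ hDcard)
      (hgood 0 (Or.inl rfl)) (hgood 1 (Or.inr rfl))
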